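/- Let $E$ be a finite-dimensional real vector space with inner product $[\cdot,\cdot]$, let $V\subseteq E$ be a linear subspace with $\dim V\le 3$, let $W=E/V^{\perp}$ be the dual space of $V$, with the inner product induced by the natural isomorphism $V\cong W$, and for $x_0\in V^{\perp}$ let $U=V+x_0$, paired with $W$ by $\langle w,u\rangle=[w,u-x_0]$. Let $\mathfrak G$ be a finite group generated by orthogonal reflections of $W$, and let $\mathcal H$ be the set of all its reflecting hyperplanes; assume that the hyperplanes in $\mathcal H$ intersect only in $0$. Let $\mathfrak G$ act on $U$ from the right by $\langle w,ug\rangle=\langle gw,u\rangle$. Let $\Phi$ be a (closed) chamber of $\mathcal H$ in $W$, and let $\Psi\subseteq U$ be the set of points $x_0+v$ with $v\in V$ such that the class of $v$ in $W$ lies in $\Phi$. Write $K^\circ$ for the relative interior of $K$. A (nonempty) polytope $P\subseteq U$ is called $\Phi$-placed if some $\gamma\in\Phi^\circ$ is constant on $P$ as a functional $\langle\gamma,\cdot\rangle$, and $\Psi$-appropriate if $P\subseteq\Psi^\circ$. Its symmetrization is $\mathfrak G(P)=\operatorname{Conv}\{xg: x\in P,\ g\in\mathfrak G\}$. The normal cone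 of $P$ at a nonempty face $F$ is $\{w\in W:\langle w,y\rangle\ge\langle w,y'\rangle\ \forall y\in F,\ y'\in P\}$, and the fundamental fan $\mathrm{FFan}(P)$ is the set of all nonempty faces of the cones $\sigma\cap\Phi$, where $\sigma$ runs over the normal cones of $P$. Let $f^i(\mathrm{FFan}(P))$ be the number of cones of codimension $i$ in $W$ in $\mathrm{FFan}(P)$, and let $f_i(Q)$ be the number of $i$-dimensional faces of a polytope $Q$; the numbers $f_i(Q)$, $0\le i\le\dim Q$, form the $f$-vector of $Q$. Then, for the given $V$ and $\mathcal H$, the two numbers $f^0(\mathrm{FFan}(P))$ and $f^1(\mathrm{FFan}(P))$ determine the $f$-vector of $\mathfrak G(P)$: there is a function $\Theta:\mathbb N\times\mathbb N\to\mathbb N^{\mathbb N}$, depending only on $V$ and $\mathcal H$, such that for all $x_0$ and $\Phi$ as above (with the corresponding $U$ and $\Psi$) and every polytope $P\subseteq U$ that is $\Phi$-placed and $\Psi$-appropriate, $$\bigl(f_i(\mathfrak G(P))\bigr)_{i\ge 0}=\Theta\bigl(f^0(\mathrm{FFan}(P)),\,f^1(\mathrm{FFan}(P))\bigr).$$ 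-/

import Mathlib

noncomputable section

namespace PolytopeSymmetrization

open Module

/-! ### Faces and face numbers -/

section Faces

variable {E : Type*} [NormedAddCommGroup E] [InnerProductSpace ℝ E]

/-- The nonempty faces of a convex set `K` (a polytope or a polyhedral cone): the nonempty subsets
of `K` on which some linear functional attains its maximum over `K`. -/
def faces (K : Set E) : Set (Set E) :=
  {F | F.Nonempty ∧ IsExposed ℝ K F}

/-- The dimension of (the affine hull of) a nonempty set. -/
def dim (F : Set E) : ℕ :=
  finrank ℝ (vectorSpan ℝ F)

/-- The `f`-vector of a polytope: `fVector P i` is the number of `i`-dimensional faces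
(so it vanishes for `i` larger than the dimension of `P`). -/
def fVector (P : Set E) : ℕ → ℕ :=
  fun i => {F | F ∈ faces P ∧ dim F = i}.ncard

/-- `fanNumber S i` is the number of cones of codimension `i` in the collection `S` of cones. -/
def fanNumber (S : Set (Set E)) (i : ℕ) : ℕ :=
  {τ | τ ∈ S ∧ dim τ + i = finrank ℝ E}.ncard

end Faces

/-! ### Finite reflection groups and their chambers -/

section Arrangement

variable {W : Type*} [NormedAddCommGroup W] [InnerProductSpace ℝ W] [FiniteDimensional ℝ W]

/-- The group generated by the orthogonal reflections in the members of `ℋ`. -/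
def reflectionGroup (ℋ : Set (Submodule ℝ W)) : Subgroup (W ≃ₗᵢ[ℝ] W) :=
  Subgroup.closure {t | ∃ H ∈ ℋ, t = H.reflection}

/-- `ℋ` is the arrangement of a finite reflection group: a finite set of linear hyperplanes which
meet only in the origin and generate a finite reflection group, such that `ℋ` consists of all
the reflecting hyperplanes of that group. -/
structure IsReflectionArrangement (ℋ : Set (Submodule ℝ W)) : Prop where
  finite : ℋ.Finite
  hyperplane : ∀ H ∈ ℋ, finrank ℝ H + 1 = finrank ℝ W
  essential : sInf ℋ = ⊥
  finite_group : Finite (reflectionGroup ℋ)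
  mem_of_reflection_mem : ∀ H : Submodule ℝ W, finrank ℝ H + 1 = finrank ℝ W →
    H.reflection ∈ reflectionGroup ℋ → H ∈ ℋ

/-- The (closed) chambers of an arrangement: the sets of all points which lie weakly on the same
side of every hyperplane as some given point `c` that lies on none of the hyperplanes. -/
def IsChamber (ℋ : Set (Submodule ℝ W)) (Φ : Set W) : Prop :=
  ∃ c : W, (∀ H ∈ ℋ, c ∉ H) ∧
    Φ = {w | ∀ H ∈ ℋ, ∀ n ∈ Hᗮ, 0 < inner ℝ n c → 0 ≤ inner ℝ n w}

end Arrangement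

/-! ### Polytopes in `U = x₀ + V`

`V` is a subspace of the Euclidean space `E` and `x₀` is orthogonal to `V`. The dual space
`W = E / Vᗮ` of `V` is represented by `V` itself: every class in `E / Vᗮ` has exactly one
representative in `V`. -/

section Symmetrization

variable {E : Type*} [NormedAddCommGroup E] [InnerProductSpace ℝ E] [FiniteDimensional ℝ E]
variable {V : Submodule ℝ E}

/-- The affine space `U = V + x₀`, as a set. -/
def affineTranslate (V : Submodule ℝ E) (x₀ : E) : Set E :=
  {u | u - x₀ ∈ V}

/-- `P` is a (nonempty) polytope in `U`: the convex hull of a nonempty finite subset of `U`. -/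
def IsPolytopeIn (U P : Set E) : Prop :=
  ∃ s : Set E, s.Finite ∧ s.Nonempty ∧ s ⊆ U ∧ P = convexHull ℝ s

/-- The pairing `⟨w, u⟩ = [w, u - x₀]` between `W` and `U`. -/
def pairing (x₀ : E) (w : V) (u : E) : ℝ :=
  inner ℝ (w : E) (u - x₀)

/-- The right action on `U = V + x₀` of an orthogonal transformation `g` of `V`. For a point `u`
of `U` the projection just reads `u - x₀` as an element of `V`. -/
def rightAction (x₀ : E) (u : E) (g : V ≃ₗᵢ[ℝ] V) : E :=
  x₀ + (g⁻¹ (V.orthogonalProjectionOnto (u - x₀)) : V)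

/-- The right action on `U` is dual to the left action on `W`. -/
theorem pairing_rightAction {x₀ u : E} (hu : u ∈ affineTranslate V x₀)
    (g : V ≃ₗᵢ[ℝ] V) (w : V) :
    pairing x₀ (g w) u = pairing x₀ w (rightAction x₀ u g) := by
  have h : V.orthogonalProjectionOnto (u - x₀) = ⟨u - x₀, hu⟩ :=
    Submodule.orthogonalProjectionOnto_mem_subspace_eq_self (K := V) ⟨u - x₀, hu⟩
  unfold pairing rightAction
  rw [h, add_sub_cancel_left]
  have h2 := g.inner_map_map w (g⁻¹ ⟨u - x₀, hu⟩)
  have h3 : g (g⁻¹ ⟨u - x₀, hu⟩) = ⟨u - x₀, hu⟩ := g.apply_symm_apply _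
  rw [h3] at h2
  exact h2

/-- The right action maps `U` to itself. -/
theorem rightAction_mem (x₀ u : E) (g : V ≃ₗᵢ[ℝ] V) :
    rightAction x₀ u g ∈ affineTranslate V x₀ := by
  unfold rightAction affineTranslate
  rw [Set.mem_ofPred_eq, add_sub_cancel_left]
  exact Submodule.coe_mem _

/-- The `G`-symmetrization of `P`: the convex hull of all the images of `P` under `G`. -/
def symmetrization (G : Subgroup (V ≃ₗᵢ[ℝ] V)) (x₀ : E) (P : Set E) : Set E :=
  convexHull ℝ {y | ∃ g ∈ G, ∃ x ∈ P, y = rightAction x₀ x g}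

/-- The normal cone of `P` at `F`: all functionals in `W` whose maximum over `P` is attained at
every point of `F`. -/
def normalCone (V : Submodule ℝ E) (x₀ : E) (F P : Set E) : Set V :=
  {w | ∀ y ∈ F, ∀ y' ∈ P, pairing x₀ w y' ≤ pairing x₀ w y}

/-- The normal fan of `P`. -/
def normalFan (V : Submodule ℝ E) (x₀ : E) (P : Set E) : Set (Set V) :=
  {σ | ∃ F ∈ faces P, σ = normalCone V x₀ F P}

/-- The fundamental fan of `P`: all nonempty faces of the cones `σ ∩ Φ`, for `σ` in the normal fan
of `P`. -/
def fundamentalFan (Φ : Set V) (x₀ : E) (P : Set E) : Set (Set V) :=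
  {τ | ∃ σ ∈ normalFan V x₀ P, τ ∈ faces (σ ∩ Φ)}

/-- The perpendicular space of `P`: all functionals in `W` that are constant on `P`. -/
def perpSpace (V : Submodule ℝ E) (x₀ : E) (P : Set E) : Set V :=
  {w | ∀ x ∈ P, ∀ y ∈ P, pairing x₀ w x = pairing x₀ w y}

/-- `P` is `Φ`-placed: some functional in the relative interior of `Φ` is constant on `P`. -/
def IsPlaced (Φ : Set V) (x₀ : E) (P : Set E) : Prop :=
  (perpSpace V x₀ P ∩ intrinsicInterior ℝ Φ).Nonempty

/-- The chamber `Ψ = Φ*` in `U` that corresponds to the chamber `Φ` in `W`. -/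
def dualChamber (Φ : Set V) (x₀ : E) : Set E :=
  {u | ∃ w ∈ Φ, u = x₀ + (w : E)}

/-- `P` is `Ψ`-appropriate: it lies in the relative interior of `Ψ`. -/
def IsAppropriate (Ψ P : Set E) : Prop :=
  P ⊆ intrinsicInterior ℝ Ψ

end Symmetrization

end PolytopeSymmetrization

end

/-! Identify `x₀ + V` with `V`, so that `P` becomes a polytope in the open chamber of a point `c`,
and let `Q` be the hull of its images under the reflection group, of order `N`. The key inequality
is `inner_map_le`: for `x` in the open chamber and `w` in the closed one, no image of `x` has a
larger product with `w` than `x` itself. By `mem_closure_of_inner_map_eq`, equality occurs only for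
products of reflections fixing `w`. Hence the face of `Q` in direction `w` is the hull of the images
of the face of `P` in direction `w` under the reflections fixing `w`.

It follows that the cones of the fundamental fan are the chamber parts of the normal cones of `Q` at
the faces selected by chamber functionals, with complementary dimension (`fanCone_eq`,
`dim_fanCone`, `chamberFan_eq`). So the fan numbers `a` and `b` count the chamber vertices and
chamber edges of `Q` (`fanNumber_eq`). Every face of `Q` is an image of exactly one chamber face,
and only stabilizers remain to be found. Those of vertices are trivial, so `f₀(Q) = N a`. A chamber
edge contained in `P` has trivial stabilizer; any other is reversed by a reflection and has
stabilizer of order two. Since `P` is placed, the chamber faces inside `P` are exactly the faces of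
`P`. This gives `2 f₁(Q) = N (b + f₁(P))` and `f₀(P) = a`.

In dimension three the placing functional is nonzero, so `dim P ≤ 2` and `f₁(P)` is a function of
`f₀(P)`. As `Q` is full-dimensional (the arrangement is essential), Euler's relation supplies the
last face number. Euler's relation is proved by integrating indicator functions against the Euler
characteristic, and the required facts on reflection groups come from the exchange condition. -/

noncomputable section

namespace PolytopeSymmetrization

open Module

/-! ### Relative interiors, algebraically -/

section RelInterior

variable {X : Type*} [AddCommGroup X] [Module ℝ X]

/-- The algebraic relative interior of `K`: the points at which every segment issuing from a point
of `K` can be prolonged inside `K`. -/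
def relInterior (K : Set X) : Set X :=
  {x | x ∈ K ∧ ∀ y ∈ K, ∃ ε : ℝ, 0 < ε ∧ x + ε • (x - y) ∈ K}

/-- `A` is algebraically relatively open. -/
def RelOpen (A : Set X) : Prop :=
  ∀ x ∈ A, ∀ y ∈ A, ∃ ε : ℝ, 0 < ε ∧ x + ε • (x - y) ∈ A

theorem relInterior_subset (K : Set X) : relInterior K ⊆ K := fun _ hx => hx.1

/-- A prolongation can be shortened. -/
theorem prolong_mem {K : Set X} (hK : Convex ℝ K) {x y : X} (hx : x ∈ K) {ε δ : ℝ}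
    (hε : x + ε • y ∈ K) (hδ : 0 ≤ δ) (h : δ ≤ ε) : x + δ • y ∈ K := by
  rcases hδ.eq_or_lt with rfl | hδ0
  · simpa using hx
  have hε0 : 0 < ε := hδ0.trans_le h
  have := hK hx hε (a := 1 - δ / ε) (b := δ / ε)
    (by rw [sub_nonneg, div_le_one hε0]; exact h) (by positivity) (by ring)
  convert this using 1
  rw [smul_add, ← add_assoc, ← add_smul, smul_smul, div_mul_cancel₀ _ hε0.ne']
  simp

/-- A prolongation available at `x` survives, shortened, at every point of the segment towards `p`
except possibly `p`. -/
theorem mem_relInterior_of_prolong {K : Set X} (hK : Convex ℝ K) {x p : X}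
    (hx : x ∈ relInterior K) (hp : p ∈ K) {t : ℝ} (ht : 0 ≤ t) (ht1 : t < 1) :
    (1 - t) • x + t • p ∈ relInterior K := by
  refine ⟨hK hx.1 hp (by linarith) ht (by ring), fun y hy => ?_⟩
  obtain ⟨ε, hε, hxy⟩ := hx.2 y hy
  have hden : 0 < 1 + ε * t := by positivity
  -- This length `δ` makes the prolonged point a convex combination of `x + ε • (x - y)` and `p`,
  -- the weight of `p` being `t + δ * t`.
  refine ⟨ε * (1 - t) / (1 + ε * t), div_pos (mul_pos hε (by linarith)) hden, ?_⟩
  set δ := ε * (1 - t) / (1 + ε * t) with hδ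
  have hδe : δ * (1 + ε * t) = ε * (1 - t) := by rw [hδ]; field_simp
  have h1 : t + δ * t ≤ 1 := by
    have : (t + δ * t) * (1 + ε * t) ≤ 1 * (1 + ε * t) := by nlinarith
    exact le_of_mul_le_mul_right this hden
  have hδ0 : 0 < δ := div_pos (mul_pos hε (by linarith)) hden
  have := hK hxy hp (a := 1 - (t + δ * t)) (b := t + δ * t) (by linarith) (by positivity) (by ring)
  convert this using 1
  have h2 : (1 - (t + δ * t)) * ε = δ := by linarith
  have h3 : (1 - (t + δ * t)) • (x + ε • (x - y)) = (1 - (t + δ * t)) • x + δ • (x - y) := by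
    rw [smul_add, smul_smul, h2]
  rw [h3]
  module

theorem mem_relInterior_of_openSegment {K : Set X} (hK : Convex ℝ K) {b x : X}
    (hb : b ∈ relInterior K) {ε : ℝ} (hε : 0 < ε) (h : x + ε • (x - b) ∈ K) :
    x ∈ relInterior K := by
  have := mem_relInterior_of_prolong hK hb h (t := (1 + ε)⁻¹) (by positivity)
    (inv_lt_one_of_one_lt₀ (by linarith))
  convert this using 1
  have h1 : (1 + ε) ≠ 0 := by positivity
  have h2 : x = ((1 + ε)⁻¹ * (1 + ε)) • x := by rw [inv_mul_cancel₀ h1, one_smul]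
  have h3 : (1 - (1 + ε)⁻¹) = (1 + ε)⁻¹ * ε := by field_simp; ring
  rw [h3]
  nth_rewrite 1 [h2]
  module

theorem convex_relInterior {K : Set X} (hK : Convex ℝ K) : Convex ℝ (relInterior K) := by
  intro x hx y hy a b ha hb hab
  rcases hb.eq_or_lt with rfl | hb0
  · simp only [add_zero] at hab; simpa [hab] using hx
  rcases ha.eq_or_lt with rfl | ha0
  · simp only [zero_add] at hab; simpa [hab] using hy
  have := mem_relInterior_of_prolong hK hx hy.1 hb (by linarith)
  rwa [← eq_sub_of_add_eq hab] at this

theorem relOpen_relInterior {K : Set X} (hK : Convex ℝ K) : RelOpen (relInterior K) := by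
  intro x hx y hy
  obtain ⟨ε, hε, h⟩ := hx.2 y hy.1
  refine ⟨ε / 2, by positivity, ?_⟩
  have := mem_relInterior_of_prolong hK hx h (t := 1 / 2) (by norm_num) (by norm_num)
  convert this using 1
  module

/-- A relatively open convex set contains a neighbourhood of each of its points inside its affine
hull. -/
theorem RelOpen.exists_add_smul_mem {A : Set X} (hA : RelOpen A) (hc : Convex ℝ A) {x : X}
    (hx : x ∈ A) {v : X} (hv : v ∈ vectorSpan ℝ A) : ∃ ε : ℝ, 0 < ε ∧ x + ε • v ∈ A := by
  rw [vectorSpan_eq_span_vsub_set_right ℝ hx] at hv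
  induction hv using Submodule.span_induction with
  | mem v hv =>
    obtain ⟨y, hy, rfl⟩ := hv
    exact ⟨1, one_pos, by simpa using hy⟩
  | zero => exact ⟨1, one_pos, by simpa using hx⟩
  | add v w _ _ hv hw =>
    obtain ⟨ε, hε, h1⟩ := hv
    obtain ⟨δ, hδ, h2⟩ := hw
    have hm : 0 < min ε δ := lt_min hε hδ
    refine ⟨min ε δ / 2, by positivity, ?_⟩
    have := hc (prolong_mem hc hx h1 hm.le (min_le_left _ _))
      (prolong_mem hc hx h2 hm.le (min_le_right _ _)) (a := 1 / 2) (b := 1 / 2)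
      (by norm_num) (by norm_num) (by norm_num)
    convert this using 1
    module
  | smul a v _ hv =>
    obtain ⟨ε, hε, h1⟩ := hv
    rcases lt_trichotomy a 0 with ha | rfl | ha
    -- Relative openness reverses the direction already obtained.
    · obtain ⟨δ, hδ, h2⟩ := hA x hx _ h1
      refine ⟨δ * ε / (-a), div_pos (by positivity) (by linarith), ?_⟩
      convert h2 using 1
      have : δ * ε / (-a) * a = -(δ * ε) := by rw [div_neg, neg_mul, div_mul_cancel₀ _ ha.ne]
      rw [smul_smul, this]
      module
    · exact ⟨1, one_pos, by simpa using hx⟩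
    · refine ⟨ε / a, by positivity, ?_⟩
      rwa [smul_smul, div_mul_cancel₀ _ ha.ne']

/-- The midpoint of a relative interior point `x` and any `y` of `K` is again relatively interior,
so `y - x` is twice a difference of relative interior points. -/
theorem vectorSpan_relInterior {K : Set X} (hK : Convex ℝ K) (h : (relInterior K).Nonempty) :
    vectorSpan ℝ (relInterior K) = vectorSpan ℝ K := by
  refine le_antisymm (vectorSpan_mono ℝ (relInterior_subset K)) ?_
  obtain ⟨x, hx⟩ := h
  rw [vectorSpan_eq_span_vsub_set_right ℝ hx.1, Submodule.span_le]
  rintro _ ⟨y, hy, rfl⟩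
  have h1 := mem_relInterior_of_prolong hK hx hy (t := 1 / 2) (by norm_num) (by norm_num)
  have h2 := Submodule.smul_mem _ (2 : ℝ) (vsub_mem_vectorSpan ℝ h1 hx)
  rw [vsub_eq_sub, show (2 : ℝ) • ((1 - 1 / 2 : ℝ) • x + (1 / 2 : ℝ) • y - x) = y - x by module] at h2
  exact h2

/-- A convex hull of a nonempty finite set has relative interior points. -/
theorem relInterior_convexHull_nonempty {s : Set X} (hs : s.Finite) (hne : s.Nonempty) :
    (relInterior (convexHull ℝ s)).Nonempty := by
  lift s to Finset X using hs
  have hne' : s.Nonempty := by simpa using hne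
  have hN : (0 : ℝ) < s.card := by exact_mod_cast hne'.card_pos
  refine ⟨∑ i ∈ s, (s.card : ℝ)⁻¹ • i, ?_, fun y hy => ?_⟩
  · rw [Finset.convexHull_eq]
    refine ⟨fun _ => (s.card : ℝ)⁻¹, fun _ _ => by positivity, by simp [hN.ne'], ?_⟩
    rw [Finset.centerMass_eq_of_sum_1 _ _ (by simp [hN.ne'])]
    simp
  · rw [Finset.convexHull_eq] at hy
    obtain ⟨w, hw0, hw1, rfl⟩ := hy
    rw [Finset.centerMass_eq_of_sum_1 _ _ hw1]
    -- Prolonging from `y` through the barycentre by the factor `1 / N` keeps all weights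
    -- nonnegative because no weight of `y` exceeds one.
    refine ⟨(s.card : ℝ)⁻¹, by positivity, ?_⟩
    rw [Finset.convexHull_eq]
    have hsum : ∑ i ∈ s, ((s.card : ℝ)⁻¹ + (s.card : ℝ)⁻¹ * ((s.card : ℝ)⁻¹ - w i)) = 1 := by
      rw [Finset.sum_add_distrib, ← Finset.mul_sum, Finset.sum_sub_distrib, hw1]
      simp [hN.ne']
    refine ⟨fun i => (s.card : ℝ)⁻¹ + (s.card : ℝ)⁻¹ * ((s.card : ℝ)⁻¹ - w i), fun i hi => ?_,
      hsum, ?_⟩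
    · have : w i ≤ 1 := hw1 ▸ Finset.single_le_sum hw0 hi
      have h3 : 0 < (s.card : ℝ)⁻¹ := by positivity
      nlinarith
    · rw [Finset.centerMass_eq_of_sum_1 _ _ hsum, ← Finset.sum_sub_distrib, Finset.smul_sum,
        ← Finset.sum_add_distrib]
      refine Finset.sum_congr rfl fun i _ => ?_
      simp only [id]
      module

/-- A point outside the relative interior has a supporting hyperplane that does not contain the
whole set. -/
theorem exists_supporting {K : Set X} (hK : Convex ℝ K) {x b : X} (hx : x ∈ K)
    (hb : b ∈ relInterior K) (hnot : x ∉ relInterior K) :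
    ∃ f : X →ₗ[ℝ] ℝ, (∀ y ∈ K, f y ≤ f x) ∧ f b < f x := by
  -- The functional comes from the Riesz extension theorem, applied to the cone of all `v` for which
  -- a small step from `x` along `-π v` stays in `K`. Projecting by `π` puts all directions
  -- transverse to `K` into the cone, so that the theorem applies in the whole space.
  obtain ⟨p, hp⟩ := (vectorSpan ℝ K).exists_isCompl
  let π : X →ₗ[ℝ] X := (vectorSpan ℝ K).subtype ∘ₗ Submodule.projectionOnto _ _ hp
  have hπ : ∀ v ∈ vectorSpan ℝ K, π v = v := fun v hv => by
    simp only [π, LinearMap.comp_apply]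
    exact congrArg Subtype.val (Submodule.projectionOnto_apply_left hp ⟨v, hv⟩)
  have hπm : ∀ v, π v ∈ vectorSpan ℝ K := fun v => Submodule.coe_mem _
  let s : PointedCone ℝ X :=
    { carrier := {v | ∃ t : ℝ, 0 < t ∧ x - t • π v ∈ K}
      zero_mem' := ⟨1, one_pos, by simpa using hx⟩
      add_mem' := by
        rintro v w ⟨t, ht, hv⟩ ⟨r, hr, hw⟩
        refine ⟨t * r / (t + r), by positivity, ?_⟩
        have := hK hv hw (a := r / (t + r)) (b := t / (t + r)) (by positivity) (by positivity)
          (by field_simp; ring)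
        convert this using 1
        have h1 : r / (t + r) + t / (t + r) = 1 := by field_simp; ring
        have h2 : x = (r / (t + r) + t / (t + r)) • x := by rw [h1, one_smul]
        nth_rewrite 1 [h2]
        rw [map_add]
        module
      smul_mem' := by
        rintro ⟨c, hc⟩ v ⟨t, ht, hv⟩
        rcases (show (0 : ℝ) ≤ c from hc).eq_or_lt with h0 | h0
        · refine ⟨1, one_pos, ?_⟩
          have : ((⟨c, hc⟩ : {c : ℝ // 0 ≤ c}) • v) = (0 : X) := by
            change c • v = 0
            rw [← h0, zero_smul]
          rw [this]
          simpa using hx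
        · refine ⟨t / c, by positivity, ?_⟩
          change x - (t / c) • π (c • v) ∈ K
          rwa [map_smul, smul_smul, div_mul_cancel₀ _ h0.ne'] }
  have hbx : x - b ≠ 0 := by
    intro h
    rw [sub_eq_zero] at h
    exact hnot (h ▸ hb)
  have hxb : x - b ∈ vectorSpan ℝ K := vsub_mem_vectorSpan ℝ hx hb.1
  let f : X →ₗ.[ℝ] ℝ := LinearPMap.mkSpanSingleton (x - b) (1 : ℝ) hbx
  have hf : ∀ (r : ℝ) (hv : r • (x - b) ∈ f.domain), f ⟨r • (x - b), hv⟩ = r := fun r hv =>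
    (LinearPMap.mkSpanSingleton'_apply (x - b) (1 : ℝ) _ r hv).trans (by simp)
  obtain ⟨g, hg, hgs⟩ := riesz_extension s f (by
    rintro ⟨v, hv⟩ ⟨t, ht, htv⟩
    obtain ⟨r, rfl⟩ := Submodule.mem_span_singleton.1 hv
    rw [hf]
    by_contra hneg
    push Not at hneg
    simp only [map_smul, hπ _ hxb, smul_smul] at htv
    -- A negative multiple of `x - b` in the cone would prolong the segment from `b` beyond `x`,
    -- making `x` relatively interior.
    refine hnot (mem_relInterior_of_openSegment hK hb (ε := t * -r) (mul_pos ht (by linarith)) ?_)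
    convert htv using 1
    module) (by
    intro y
    obtain ⟨ε, hε, h⟩ := (relOpen_relInterior hK).exists_add_smul_mem (convex_relInterior hK) hb
      (v := -π y) (by rw [vectorSpan_relInterior hK ⟨b, hb⟩]; exact neg_mem (hπm y))
    refine ⟨⟨ε⁻¹ • (x - b), Submodule.smul_mem _ _ (Submodule.mem_span_singleton_self _)⟩,
      ε, hε, ?_⟩
    convert h.1 using 1
    simp only [map_add, map_smul, hπ _ hxb, smul_add, smul_smul, mul_inv_cancel₀ hε.ne']
    module)
  refine ⟨g, fun y hy => ?_, ?_⟩
  · have := hgs (x - y) ⟨1, one_pos, by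
      rw [hπ _ (show x - y ∈ _ from vsub_mem_vectorSpan ℝ hx hy)]
      simpa using hy⟩
    rw [map_sub] at this
    linarith
  · have h1 := (hg ⟨(1 : ℝ) • (x - b), Submodule.smul_mem _ _
      (Submodule.mem_span_singleton_self _)⟩).trans (hf 1 _)
    simp only [one_smul, map_sub] at h1
    linarith

end RelInterior

/-- The line through two points of `K` stays in the affine span, so by continuity a short step
backwards from an intrinsic interior point remains in `K`. -/
theorem mem_relInterior_of_mem_intrinsicInterior {X : Type*} [NormedAddCommGroup X]
    [NormedSpace ℝ X] {K : Set X} {x : X} (hx : x ∈ intrinsicInterior ℝ K) :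
    x ∈ relInterior K := by
  refine ⟨intrinsicInterior_subset hx, fun y hy => ?_⟩
  obtain ⟨z, hz, rfl⟩ := mem_intrinsicInterior.1 hx
  have hy' : y ∈ affineSpan ℝ K := subset_affineSpan ℝ K hy
  let f : ℝ → affineSpan ℝ K := fun t =>
    ⟨AffineMap.lineMap (z : X) y (-t), AffineMap.lineMap_mem _ z.2 hy'⟩
  have hf : Continuous f := by
    refine Continuous.subtype_mk ?_ _
    simp only [AffineMap.lineMap_apply]
    fun_prop
  have h0 : f 0 = z := Subtype.ext (by simp [f])
  have h1 : ∀ᶠ t in nhds (0 : ℝ), f t ∈ interior (((↑) : affineSpan ℝ K → X) ⁻¹' K) :=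
    hf.continuousAt.eventually (by rw [h0]; exact isOpen_interior.mem_nhds hz)
  obtain ⟨t, ht, ht0⟩ := ((h1.filter_mono nhdsWithin_le_nhds).and
    (self_mem_nhdsWithin (s := Set.Ioi (0 : ℝ)))).exists
  refine ⟨t, ht0, ?_⟩
  have h2 : f t ∈ ((↑) : affineSpan ℝ K → X) ⁻¹' K := interior_subset ht
  have h3 : ((f t : affineSpan ℝ K) : X) = z + t • ((z : X) - y) := by
    simp only [f, AffineMap.lineMap_apply, vsub_eq_sub, vadd_eq_add]
    module
  rw [← h3]
  exact h2

/-! ### Integration with respect to the Euler characteristic -/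

section Euler

open Filter Topology

/-- `HasEulerIntegral f c`: the integral of `f : ℝⁿ → ℤ` with respect to the Euler characteristic
exists and equals `c`. It is computed one coordinate at a time; a function `g` on the line has the
integral `∑ (g t - g (t+))`. -/
def HasEulerIntegral : ∀ {n : ℕ}, ((Fin n → ℝ) → ℤ) → ℤ → Prop
  | 0, f, c => ∀ x, f x = c
  | _ + 1, f, c => ∃ g r : ℝ → ℤ,
      (∀ t, HasEulerIntegral (fun y => f (Fin.cons t y)) (g t)) ∧
      (∀ t, ∀ᶠ s in 𝓝[>] t, g s = r t) ∧
      (Function.support (g - r)).Finite ∧ ∑ᶠ t, (g - r) t = c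

theorem HasEulerIntegral.unique : ∀ {n : ℕ} {f : (Fin n → ℝ) → ℤ} {c d : ℤ},
    HasEulerIntegral f c → HasEulerIntegral f d → c = d
  | 0, _, _, _, hc, hd => (hc 0).symm.trans (hd 0)
  | _ + 1, _, _, _, ⟨g, r, hg, hr, _, hc⟩, ⟨g', r', hg', hr', _, hd⟩ => by
    have h1 : g = g' := funext fun t => (hg t).unique (hg' t)
    subst h1
    have h2 : r = r' := funext fun t => by
      obtain ⟨s, h, h'⟩ := ((hr t).and (hr' t)).exists
      exact h.symm.trans h'
    subst h2
    exact hc.symm.trans hd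

theorem HasEulerIntegral.zero : ∀ {n : ℕ}, HasEulerIntegral (fun _ : Fin n → ℝ => 0) 0
  | 0 => fun _ => rfl
  | n + 1 => ⟨0, 0, fun _ => HasEulerIntegral.zero (n := n), fun _ => by simp, by simp, by simp⟩

theorem HasEulerIntegral.add : ∀ {n : ℕ} {f f' : (Fin n → ℝ) → ℤ} {c d : ℤ},
    HasEulerIntegral f c → HasEulerIntegral f' d → HasEulerIntegral (fun x => f x + f' x) (c + d)
  | 0, _, _, _, _, hc, hd => fun x => by simp only [hc x, hd x]
  | _ + 1, _, _, _, _, ⟨g, r, hg, hr, hf, hc⟩, ⟨g', r', hg', hr', hf', hd⟩ => by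
    have e : g + g' - (r + r') = (g - r) + (g' - r') := by abel
    refine ⟨g + g', r + r', fun t => (hg t).add (hg' t), fun t => ?_, ?_, ?_⟩
    · filter_upwards [hr t, hr' t] with s h h'
      simp [h, h']
    · rw [e]
      exact (hf.union hf').subset (Function.support_add _ _)
    · rw [e, ← hc, ← hd]
      exact finsum_add_distrib hf hf'

theorem HasEulerIntegral.sum {n : ℕ} {ι : Type*} (s : Finset ι) {f : ι → (Fin n → ℝ) → ℤ}
    {c : ι → ℤ} (h : ∀ i ∈ s, HasEulerIntegral (f i) (c i)) :
    HasEulerIntegral (fun x => ∑ i ∈ s, f i x) (∑ i ∈ s, c i) := by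
  classical
  induction s using Finset.induction_on with
  | empty => simpa using HasEulerIntegral.zero
  | insert a s ha ih =>
    simp only [Finset.sum_insert ha]
    exact (h a (Finset.mem_insert_self _ _)).add
      (ih fun i hi => h i (Finset.mem_insert_of_mem hi))

theorem slice_indicator {n : ℕ} (A : Set (Fin (n + 1) → ℝ)) (t : ℝ) :
    (fun y : Fin n → ℝ => A.indicator (1 : (Fin (n + 1) → ℝ) → ℤ) (Fin.cons t y)) =
      ((fun y => (Fin.cons t y : Fin (n + 1) → ℝ)) ⁻¹' A).indicator 1 := by
  classical
  funext y
  simp [Set.indicator_apply]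

theorem cons_combo {n : ℕ} (t s : ℝ) (x y : Fin n → ℝ) (a b : ℝ) :
    a • (Fin.cons t x : Fin (n + 1) → ℝ) + b • (Fin.cons s y : Fin (n + 1) → ℝ) =
      Fin.cons (a * t + b * s) (a • x + b • y) := by
  funext i
  refine Fin.cases ?_ (fun j => ?_) i <;> simp

theorem convex_slice {n : ℕ} {A : Set (Fin (n + 1) → ℝ)} (hA : Convex ℝ A) (t : ℝ) :
    Convex ℝ ((fun y : Fin n → ℝ => (Fin.cons t y : Fin (n + 1) → ℝ)) ⁻¹' A) := by
  intro x hx y hy a b ha hb hab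
  have := hA hx hy ha hb hab
  rw [cons_combo, ← add_mul, hab, one_mul] at this
  exact this

theorem relOpen_slice {n : ℕ} {A : Set (Fin (n + 1) → ℝ)} (hA : RelOpen A) (t : ℝ) :
    RelOpen ((fun y : Fin n → ℝ => (Fin.cons t y : Fin (n + 1) → ℝ)) ⁻¹' A) := by
  intro x hx y hy
  obtain ⟨ε, hε, h⟩ := hA _ hx _ hy
  refine ⟨ε, hε, ?_⟩
  have e : (Fin.cons t (x + ε • (x - y)) : Fin (n + 1) → ℝ) =
      Fin.cons t x + ε • (Fin.cons t x - Fin.cons t y : Fin (n + 1) → ℝ) := by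
    funext i
    refine Fin.cases ?_ (fun j => ?_) i <;> simp
  rw [← e] at h
  exact h

/-- By induction the slice integrals form the indicator of a compact interval `[a, b]`; its right
limits form that of `[a, b)`, so the only jump is `1`, at `b`. -/
theorem hasEulerIntegral_compact : ∀ {n : ℕ} {K : Set (Fin n → ℝ)}, IsCompact K → Convex ℝ K →
    K.Nonempty → HasEulerIntegral (K.indicator 1) 1
  | 0, K, _, _, hne => fun x => by
    obtain ⟨y, hy⟩ := hne
    rw [Subsingleton.elim x y]
    simp [hy]
  | n + 1, K, hK, hc, hne => by
    classical
    let I : Set ℝ := (fun x : Fin (n + 1) → ℝ => x 0) '' K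
    have hIc : IsCompact I := hK.image (continuous_apply 0)
    have hIconv : Convex ℝ I := hc.linear_image (LinearMap.proj (R := ℝ) 0)
    have hIne : I.Nonempty := hne.image _
    have hI : I = Set.Icc (sInf I) (sSup I) :=
      eq_Icc_of_connected_compact ⟨hIne, hIconv.isPreconnected⟩ hIc
    set a := sInf I
    set b := sSup I
    have hab : a ≤ b := by
      obtain ⟨x, hx⟩ := hIne
      rw [hI] at hx
      exact hx.1.trans hx.2
    refine ⟨(Set.Icc a b).indicator 1, (Set.Ico a b).indicator 1, fun t => ?_, fun t => ?_, ?_⟩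
    · rw [slice_indicator]
      by_cases ht : t ∈ Set.Icc a b
      · rw [Set.indicator_of_mem ht]
        refine hasEulerIntegral_compact ?_ (convex_slice hc t) ?_
        · have e : (fun y : Fin n → ℝ => (Fin.cons t y : Fin (n + 1) → ℝ)) ⁻¹' K =
              (fun x : Fin (n + 1) → ℝ => Fin.tail x) '' (K ∩ {x | x 0 = t}) := by
            ext y
            constructor
            · intro hy
              exact ⟨Fin.cons t y, ⟨hy, rfl⟩, Fin.tail_cons _ _⟩
            · rintro ⟨x, ⟨hx, rfl⟩, rfl⟩
              simpa using hx
          rw [e]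
          refine (hK.inter_right (isClosed_eq (continuous_apply 0) continuous_const)).image ?_
          exact continuous_pi fun i => continuous_apply _
        · rw [← hI] at ht
          obtain ⟨x, hx, rfl⟩ := ht
          exact ⟨Fin.tail x, by simpa using hx⟩
      · rw [Set.indicator_of_notMem ht]
        have e : (fun y : Fin n → ℝ => (Fin.cons t y : Fin (n + 1) → ℝ)) ⁻¹' K = ∅ := by
          ext y
          simp only [Set.mem_preimage, Set.mem_empty_iff_false, iff_false]
          intro hy
          exact ht (hI ▸ ⟨_, hy, rfl⟩)
        rw [e, Set.indicator_empty]
        exact HasEulerIntegral.zero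
    · by_cases h1 : t < a
      · filter_upwards [Ioo_mem_nhdsGT h1] with s hs
        simp [hs.2.not_ge, h1.not_ge]
      by_cases h2 : t < b
      · filter_upwards [Ioo_mem_nhdsGT h2] with s hs
        have : a ≤ s := (not_lt.1 h1).trans hs.1.le
        simp [hs.2.le, this, h2, not_lt.1 h1]
      · filter_upwards [self_mem_nhdsWithin] with s hs
        have : b < s := (not_lt.1 h2).trans_lt hs
        simp [this.not_ge, h2]
    · have e : (Set.Icc a b).indicator (1 : ℝ → ℤ) - (Set.Ico a b).indicator 1 =
          Pi.single b 1 := by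
        funext t
        rcases eq_or_ne t b with rfl | h
        · simp [hab, b]
        · have : t ≤ b ↔ t < b := ⟨fun h' => lt_of_le_of_ne h' h, le_of_lt⟩
          simp [Set.indicator_apply, this, h]
      rw [e]
      refine ⟨(Set.finite_singleton b).subset Pi.support_single_subset, ?_⟩
      rw [finsum_eq_single _ b (fun x hx => by simp [hx])]
      simp

/-- If `I` is not a single point, each of its points has points of `I` on both sides, so neither the
infimum nor the supremum is attained. -/
theorem relOpen_real {I : Set ℝ} (hI : Convex ℝ I) (ho : RelOpen I) (hne : I.Nonempty)
    (hb : Bornology.IsBounded I) : (∃ a, I = {a}) ∨ ∃ a b, a < b ∧ I = Set.Ioo a b := by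
  rcases hne.exists_eq_singleton_or_nontrivial with h | h
  · exact Or.inl h
  right
  have key : ∀ x ∈ I, (∃ y ∈ I, y < x) ∧ ∃ y ∈ I, x < y := by
    intro x hx
    obtain ⟨y, hy, hyx⟩ := h.exists_ne x
    obtain ⟨ε, hε, hm⟩ := ho x hx y hy
    simp only [smul_eq_mul] at hm
    rcases lt_or_gt_of_ne hyx with h | h
    · exact ⟨⟨y, hy, h⟩, _, hm, by nlinarith⟩
    · exact ⟨⟨_, hm, by nlinarith⟩, y, hy, h⟩
  have hbb := hb.bddBelow
  have hba := hb.bddAbove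
  have e : I = Set.Ioo (sInf I) (sSup I) := by
    ext x
    constructor
    · intro hx
      obtain ⟨⟨y, hy, hyx⟩, z, hz, hzx⟩ := key x hx
      exact ⟨(csInf_le hbb hy).trans_lt hyx, hzx.trans_le (le_csSup hba hz)⟩
    · rintro ⟨h1, h2⟩
      obtain ⟨y, hy, hyx⟩ := exists_lt_of_csInf_lt hne h1
      obtain ⟨z, hz, hzx⟩ := exists_lt_of_lt_csSup hne h2
      exact hI.ordConnected.out hy hz ⟨hyx.le, hzx.le⟩
  obtain ⟨x, hx⟩ := hne
  exact ⟨_, _, by rw [e] at hx; exact hx.1.trans hx.2, e⟩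

/-- The dimension of a relatively open convex set is that of a nonempty slice plus that of its
projection. -/
theorem finrank_vectorSpan_slice {n : ℕ} {A : Set (Fin (n + 1) → ℝ)} (hA : RelOpen A)
    (hc : Convex ℝ A) {t : ℝ} {y : Fin n → ℝ} (hy : (Fin.cons t y : Fin (n + 1) → ℝ) ∈ A) :
    finrank ℝ (vectorSpan ℝ A) =
      finrank ℝ (vectorSpan ℝ ((fun x : Fin (n + 1) → ℝ => x 0) '' A)) +
      finrank ℝ (vectorSpan ℝ
        ((fun y : Fin n → ℝ => (Fin.cons t y : Fin (n + 1) → ℝ)) ⁻¹' A)) := by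
  let e : (Fin (n + 1) → ℝ) →ₗ[ℝ] ℝ := LinearMap.proj 0
  let c : (Fin n → ℝ) →ₗ[ℝ] (Fin (n + 1) → ℝ) :=
    { toFun := fun y => Fin.cons 0 y
      map_add' := fun x y => by
        funext i; refine Fin.cases ?_ (fun j => ?_) i <;> simp
      map_smul' := fun a y => by
        funext i; refine Fin.cases ?_ (fun j => ?_) i <;> simp }
  have hcinj : Function.Injective c := fun x y h =>
    funext fun i => by simpa [c] using congrFun h i.succ
  set S := (fun y : Fin n → ℝ => (Fin.cons t y : Fin (n + 1) → ℝ)) ⁻¹' A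
  set D := vectorSpan ℝ A
  -- Rank-nullity for the first coordinate on `D` will give the claim. Relative openness is used
  -- here: a direction of `D` with vanishing first coordinate can be followed from `y` inside the
  -- slice.
  have h1 : (vectorSpan ℝ S).map c = D ⊓ LinearMap.ker e := by
    apply le_antisymm
    · rw [vectorSpan_eq_span_vsub_set_right ℝ (show y ∈ S from hy), Submodule.map_span,
        Submodule.span_le]
      rintro _ ⟨_, ⟨z, hz, rfl⟩, rfl⟩
      refine ⟨?_, by simp [e, c]⟩
      have := vsub_mem_vectorSpan ℝ (show Fin.cons t z ∈ A from hz) hy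
      have e' : c (z -ᵥ y) = (Fin.cons t z : Fin (n + 1) → ℝ) -ᵥ Fin.cons t y := by
        funext i
        refine Fin.cases ?_ (fun j => ?_) i <;> simp [c]
      rw [← e'] at this
      exact this
    · rintro v ⟨hv, hv0⟩
      obtain ⟨ε, hε, h⟩ := hA.exists_add_smul_mem hc hy hv
      have hv0' : v 0 = 0 := hv0
      have hv' : v = Fin.cons 0 (Fin.tail v) := by
        rw [← hv0']; exact (Fin.cons_self_tail v).symm
      have h2 : y + ε • Fin.tail v ∈ S := by
        change Fin.cons t (y + ε • Fin.tail v) ∈ A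
        convert h using 1
        funext i
        refine Fin.cases ?_ (fun j => ?_) i <;> simp [hv0', Fin.tail]
      have h3 := vsub_mem_vectorSpan ℝ h2 (show y ∈ S from hy)
      rw [vsub_eq_sub, add_sub_cancel_left] at h3
      have h4 := Submodule.smul_mem _ ε⁻¹ h3
      rw [smul_smul, inv_mul_cancel₀ hε.ne', one_smul] at h4
      exact ⟨_, h4, hv'.symm⟩
  have h2 : D.map e = vectorSpan ℝ ((fun x : Fin (n + 1) → ℝ => x 0) '' A) :=
    AffineMap.map_vectorSpan e.toAffineMap
  have h3 := LinearMap.finrank_range_add_finrank_ker (e.domRestrict D)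
  rw [LinearMap.range_domRestrict, h2] at h3
  rw [← h3, (Submodule.equivMapOfInjective c hcinj _).finrank_eq, h1]
  congr 1
  have h4 : (LinearMap.ker (e.domRestrict D)).map D.subtype = D ⊓ LinearMap.ker e := by
    rw [LinearMap.ker_domRestrict, Submodule.map_comap_subtype]
  rw [← h4]
  exact (Submodule.finrank_map_subtype_eq _ _).symm

/-- If the first coordinate is constant on `A`, the single slice carries the whole integral.
Otherwise the slices over an open interval `(a, b)` have one dimension less, and the only jump, at
`a`, is from `0` to `-(-1) ^ m`; it contributes `(-1) ^ m`. -/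
theorem hasEulerIntegral_relOpen : ∀ {n : ℕ} {A : Set (Fin n → ℝ)} {R : ℝ}, RelOpen A →
    Convex ℝ A → A.Nonempty → (∀ x ∈ A, ∀ i, |x i| ≤ R) →
    HasEulerIntegral (A.indicator 1) ((-1) ^ finrank ℝ (vectorSpan ℝ A))
  | 0, A, _, _, _, hne, _ => fun x => by
    obtain ⟨y, hy⟩ := hne
    rw [Subsingleton.elim x y]
    have : finrank ℝ (vectorSpan ℝ A) = 0 :=
      Nat.le_zero.1 ((Submodule.finrank_le _).trans (by simp))
    simp [hy, this]
  | n + 1, A, R, ho, hc, hne, hR => by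
    classical
    let I : Set ℝ := (fun x : Fin (n + 1) → ℝ => x 0) '' A
    have hIo : RelOpen I := by
      rintro _ ⟨x, hx, rfl⟩ _ ⟨y, hy, rfl⟩
      obtain ⟨ε, hε, h⟩ := ho x hx y hy
      exact ⟨ε, hε, _, h, by simp⟩
    have hIc : Convex ℝ I := hc.linear_image (LinearMap.proj (R := ℝ) 0)
    have hIb : Bornology.IsBounded I := by
      refine (Metric.isBounded_Icc (-R) R).subset ?_
      rintro _ ⟨x, hx, rfl⟩
      exact abs_le.1 (hR x hx 0)
    have hslice : ∀ t ∈ I, HasEulerIntegral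
        (((fun y : Fin n → ℝ => (Fin.cons t y : Fin (n + 1) → ℝ)) ⁻¹' A).indicator 1)
        ((-1) ^ finrank ℝ (vectorSpan ℝ
          ((fun y : Fin n → ℝ => (Fin.cons t y : Fin (n + 1) → ℝ)) ⁻¹' A))) := by
      rintro _ ⟨x, hx, rfl⟩
      exact hasEulerIntegral_relOpen (R := R) (relOpen_slice ho _) (convex_slice hc _)
        ⟨Fin.tail x, by simpa using hx⟩ (fun y hy i => by simpa using hR _ hy i.succ)
    have hdim : ∀ t ∈ I, finrank ℝ (vectorSpan ℝ A) = finrank ℝ (vectorSpan ℝ I) +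
        finrank ℝ (vectorSpan ℝ
          ((fun y : Fin n → ℝ => (Fin.cons t y : Fin (n + 1) → ℝ)) ⁻¹' A)) := by
      rintro _ ⟨x, hx, rfl⟩
      exact finrank_vectorSpan_slice ho hc (y := Fin.tail x) (by simpa using hx)
    have hempty : ∀ t ∉ I,
        (fun y : Fin n → ℝ => (Fin.cons t y : Fin (n + 1) → ℝ)) ⁻¹' A = ∅ := by
      intro t ht
      ext y
      simp only [Set.mem_preimage, Set.mem_empty_iff_false, iff_false]
      exact fun hy => ht ⟨_, hy, rfl⟩
    set m := finrank ℝ (vectorSpan ℝ A)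
    rcases relOpen_real hIc hIo (hne.image _) hIb with ⟨a, hI⟩ | ⟨a, b, hab, hI⟩
    · refine ⟨Pi.single a ((-1) ^ m), 0, fun t => ?_, fun t => ?_, ?_, ?_⟩
      · rw [slice_indicator]
        rcases eq_or_ne t a with rfl | h
        · have ht : t ∈ I := hI ▸ rfl
          have := hdim t ht
          rw [hI, vectorSpan_singleton, finrank_bot, zero_add] at this
          rw [Pi.single_eq_same, this]
          exact hslice t ht
        · rw [hempty t (by rw [hI]; exact h), Set.indicator_empty, Pi.single_eq_of_ne h]
          exact HasEulerIntegral.zero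
      · have : ∀ᶠ s in 𝓝[>] t, s ≠ a := by
          rcases lt_or_ge t a with h | h
          · filter_upwards [Ioo_mem_nhdsGT h] with s hs using hs.2.ne
          · filter_upwards [self_mem_nhdsWithin] with s hs using (h.trans_lt hs).ne'
        filter_upwards [this] with s hs
        simp [hs]
      · rw [sub_zero]
        exact (Set.finite_singleton a).subset Pi.support_single_subset
      · rw [sub_zero, finsum_eq_single _ a (fun x hx => by simp [hx])]
        simp
    · have hfr : finrank ℝ (vectorSpan ℝ I) = 1 := by
        have : vectorSpan ℝ I = ⊤ := by
          rw [hI, ← direction_affineSpan,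
            (isOpen_Ioo.affineSpan_eq_top (Set.nonempty_Ioo.2 hab)), AffineSubspace.direction_top]
        rw [this, finrank_top, finrank_self]
      refine ⟨(Set.Ioo a b).indicator (fun _ => -(-1) ^ m),
        (Set.Ico a b).indicator (fun _ => -(-1) ^ m), fun t => ?_, fun t => ?_, ?_⟩
      · rw [slice_indicator]
        by_cases ht : t ∈ Set.Ioo a b
        · rw [Set.indicator_of_mem ht]
          rw [← hI] at ht
          have := hdim t ht
          rw [hfr] at this
          rw [this, pow_add, pow_one, neg_mul, one_mul, neg_neg]
          exact hslice t ht
        · rw [Set.indicator_of_notMem ht, hempty t (by rwa [hI]), Set.indicator_empty]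
          exact HasEulerIntegral.zero
      · by_cases h1 : t < a
        · filter_upwards [Ioo_mem_nhdsGT h1] with s hs
          simp [hs.2.not_gt, h1.not_ge]
        by_cases h2 : t < b
        · filter_upwards [Ioo_mem_nhdsGT h2] with s hs
          have : a < s := (not_lt.1 h1).trans_lt hs.1
          simp [hs.2, this, h2, not_lt.1 h1]
        · filter_upwards [self_mem_nhdsWithin] with s hs
          have : b < s := (not_lt.1 h2).trans_lt hs
          simp [this.not_gt, h2]
      · have e : (Set.Ioo a b).indicator (fun _ => -(-1 : ℤ) ^ m) -
            (Set.Ico a b).indicator (fun _ => -(-1) ^ m) = Pi.single a ((-1) ^ m) := by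
          funext t
          rcases eq_or_ne t a with rfl | h
          · simp [hab]
          · have : a ≤ t ↔ a < t := ⟨fun h' => lt_of_le_of_ne h' h.symm, le_of_lt⟩
            simp [Set.indicator_apply, this, h]
        rw [e]
        refine ⟨(Set.finite_singleton a).subset Pi.support_single_subset, ?_⟩
        rw [finsum_eq_single _ a (fun x hx => by simp [hx])]
        simp

end Euler

/-! ### Faces of polytopes -/

section PolytopeFaces

open Filter Topology

variable {X : Type*} [NormedAddCommGroup X] [InnerProductSpace ℝ X]

/-- The set of points of `K` at which the functional `⟪w, ·⟫` is maximal. -/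
def face (K : Set X) (w : X) : Set X :=
  {x | x ∈ K ∧ ∀ y ∈ K, inner ℝ w y ≤ inner ℝ w x}

theorem face_subset (K : Set X) (w : X) : face K w ⊆ K := fun _ hx => hx.1

theorem mem_faces_iff [FiniteDimensional ℝ X] {K F : Set X} :
    F ∈ faces K ↔ F.Nonempty ∧ ∃ w, F = face K w := by
  constructor
  · rintro ⟨h, he⟩
    obtain ⟨l, rfl⟩ := he h
    refine ⟨h, (InnerProductSpace.toDual ℝ X).symm l, ?_⟩
    simp [face]
  · rintro ⟨h, w, rfl⟩
    exact ⟨h, fun _ => ⟨InnerProductSpace.toDual ℝ X w, by simp [face]⟩⟩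

theorem inner_eq_of_mem_face {K : Set X} {w x y : X} (hx : x ∈ face K w) (hy : y ∈ face K w) :
    inner ℝ w x = inner ℝ w y :=
  le_antisymm (hy.2 x hx.1) (hx.2 y hy.1)

theorem mem_face_of_inner_eq {K : Set X} {w x y : X} (hx : x ∈ face K w) (hy : y ∈ K)
    (h : inner ℝ w x = inner ℝ w y) : y ∈ face K w :=
  ⟨hy, fun z hz => h ▸ hx.2 z hz⟩

theorem face_zero (K : Set X) : face K 0 = K := by
  ext x
  simp [face]

theorem face_nonempty {K : Set X} (hK : IsCompact K) (hne : K.Nonempty) (w : X) :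
    (face K w).Nonempty := by
  obtain ⟨x, hx, h⟩ := hK.exists_isMaxOn hne (f := fun y => inner ℝ w y)
    (Continuous.continuousOn (by fun_prop))
  exact ⟨x, hx, fun y hy => h hy⟩

theorem convex_face {K : Set X} (hK : Convex ℝ K) (w : X) : Convex ℝ (face K w) := by
  intro x hx y hy a b ha hb hab
  refine mem_face_of_inner_eq hx (hK hx.1 hy.1 ha hb hab) ?_
  rw [inner_add_right, inner_smul_right, inner_smul_right, ← inner_eq_of_mem_face hx hy, ← add_mul,
    hab, one_mul]

theorem face_add {K : Set X} {v w x : X} (hv : x ∈ face K v) (hw : x ∈ face K w) :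
    face K (v + w) = face K v ∩ face K w := by
  ext y
  constructor
  · intro hy
    have h1 := hy.2 x hv.1
    rw [inner_add_left, inner_add_left] at h1
    have h2 := hv.2 y hy.1
    have h3 := hw.2 y hy.1
    exact ⟨mem_face_of_inner_eq hv hy.1 (by linarith), mem_face_of_inner_eq hw hy.1 (by linarith)⟩
  · rintro ⟨h1, h2⟩
    refine ⟨h1.1, fun z hz => ?_⟩
    rw [inner_add_left, inner_add_left]
    exact add_le_add (h1.2 z hz) (h2.2 z hz)

theorem inner_le_of_mem_convexHull {T : Set X} {w x : X} {M : ℝ}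
    (h : ∀ t ∈ T, inner ℝ w t ≤ M) (hx : x ∈ convexHull ℝ T) : inner ℝ w x ≤ M := by
  have hc : Convex ℝ {y : X | inner ℝ w y ≤ M} :=
    convex_halfSpace_le (f := fun y => inner ℝ w y)
      ⟨fun x y => inner_add_right _ _ _, fun a x => inner_smul_right _ _ _⟩ M
  exact convexHull_min (s := T) h hc hx

/-- In a convex combination of points of `T` that maximizes `w`, the nonnegative deficits of the
points have weighted sum zero, so every point of nonzero weight is itself a maximizer. -/
theorem face_convexHull (T : Set X) (w : X) :
    face (convexHull ℝ T) w = convexHull ℝ (T ∩ face (convexHull ℝ T) w) := by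
  apply Set.Subset.antisymm
  · intro x hx
    obtain ⟨ι, s, c, z, hc0, hc1, hz, hzx⟩ :=
      mem_convexHull_iff_exists_fintype.1 hx.1
    have hle : ∀ i, inner ℝ w (z i) ≤ inner ℝ w x := fun i =>
      hx.2 _ (subset_convexHull ℝ T (hz i))
    have hsum : ∑ i, c i * (inner ℝ w x - inner ℝ w (z i)) = 0 := by
      simp only [mul_sub, Finset.sum_sub_distrib, ← Finset.sum_mul, hc1, one_mul]
      nth_rewrite 1 [← hzx]
      rw [inner_sum]
      simp [inner_smul_right]
    have h0 : ∀ i, c i * (inner ℝ w x - inner ℝ w (z i)) = 0 := by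
      have := (Finset.sum_eq_zero_iff_of_nonneg
        (fun i _ => mul_nonneg (hc0 i) (sub_nonneg.2 (hle i)))).1 hsum
      exact fun i => this i (Finset.mem_univ i)
    rw [← hzx]
    have hx' : ∑ i, c i • z i = ∑ i ∈ Finset.univ.filter (fun i => c i ≠ 0), c i • z i := by
      rw [Finset.sum_filter_of_ne]
      intro i _ h h'
      exact h (by rw [h', zero_smul])
    rw [hx']
    refine (convex_convexHull ℝ _).sum_mem (fun i _ => hc0 i) ?_ ?_
    · rw [← hc1, Finset.sum_filter_of_ne]
      exact fun i _ h => h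
    · intro i hi
      refine subset_convexHull ℝ _ ⟨hz i, mem_face_of_inner_eq hx (subset_convexHull ℝ T (hz i)) ?_⟩
      have := (mul_eq_zero.1 (h0 i)).resolve_left (Finset.mem_filter.1 hi).2
      linarith
  · exact convexHull_min Set.inter_subset_right (convex_face (convex_convexHull ℝ T) w)

theorem faces_finite [FiniteDimensional ℝ X] {T : Set X} (hT : T.Finite) :
    (faces (convexHull ℝ T)).Finite := by
  refine Set.Finite.subset (hT.finite_subsets.image (fun S => convexHull ℝ S)) ?_
  intro F hF
  obtain ⟨-, w, rfl⟩ := mem_faces_iff.1 hF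
  exact ⟨_, Set.inter_subset_left, (face_convexHull T w).symm⟩

/-- The points of `T` off the face of `w` are below its maximum by a gap that a small multiple of
`u` cannot close; on the face, `u` alone decides. -/
theorem eventually_face_subset {T : Set X} (hT : T.Finite) {w u : X}
    (hne : (face (face (convexHull ℝ T) w) u).Nonempty) :
    ∀ᶠ ε in 𝓝[>] (0 : ℝ),
      face (face (convexHull ℝ T) w) u ⊆ face (convexHull ℝ T) (w + ε • u) := by
  obtain ⟨x₀, hx₀⟩ := hne
  have h1 : ∀ t ∈ T, ∀ᶠ ε in 𝓝[>] (0 : ℝ), inner ℝ (w + ε • u) t ≤ inner ℝ (w + ε • u) x₀ := by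
    intro t ht
    have ht' := subset_convexHull ℝ T ht
    by_cases htF : t ∈ face (convexHull ℝ T) w
    · filter_upwards [self_mem_nhdsWithin] with ε hε
      rw [inner_add_left, inner_add_left, inner_smul_left, inner_smul_left,
        inner_eq_of_mem_face htF hx₀.1]
      have := mul_le_mul_of_nonneg_left (hx₀.2 t htF) (le_of_lt hε)
      simpa using this
    · have hlt : inner ℝ w t < inner ℝ w x₀ :=
        lt_of_le_of_ne (hx₀.1.2 t ht') fun h => htF (mem_face_of_inner_eq hx₀.1 ht' h.symm)
      have hcont : Continuous fun ε : ℝ =>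
          inner ℝ (w + ε • u) x₀ - inner ℝ (w + ε • u) t := by fun_prop
      have : ∀ᶠ ε in 𝓝 (0 : ℝ), 0 < inner ℝ (w + ε • u) x₀ - inner ℝ (w + ε • u) t :=
        hcont.continuousAt.eventually (Ioi_mem_nhds (by simpa using hlt))
      exact (this.filter_mono nhdsWithin_le_nhds).mono fun ε h => by linarith
  filter_upwards [(eventually_all_finite hT).2 h1] with ε hε x hx
  have hxx : inner ℝ (w + ε • u) x = inner ℝ (w + ε • u) x₀ := by
    rw [inner_add_left, inner_add_left, inner_smul_left, inner_smul_left,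
      inner_eq_of_mem_face hx.1 hx₀.1, inner_eq_of_mem_face hx hx₀]
  exact ⟨hx.1.1, fun y hy => hxx ▸ inner_le_of_mem_convexHull hε hy⟩

/-- The relative interiors of the faces cover a polytope. -/
theorem exists_mem_relInterior_face [FiniteDimensional ℝ X] {T : Set X} (hT : T.Finite) {x : X}
    (hx : x ∈ convexHull ℝ T) : ∃ F ∈ faces (convexHull ℝ T), x ∈ relInterior F := by
  set K := convexHull ℝ T with hKdef
  have hfin : {F | F ∈ faces K ∧ x ∈ F}.Finite := (faces_finite hT).subset fun F hF => hF.1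
  have hKf : K ∈ {F | F ∈ faces K ∧ x ∈ F} :=
    ⟨mem_faces_iff.2 ⟨⟨x, hx⟩, 0, (face_zero K).symm⟩, hx⟩
  -- In a minimal face containing `x`, a supporting functional at a relative boundary point `x`
  -- would, after perturbation, cut out a smaller face that still contains `x` but misses `b`.
  obtain ⟨F, hF⟩ := hfin.exists_minimal ⟨K, hKf⟩
  refine ⟨F, hF.1.1, ?_⟩
  by_contra hnot
  obtain ⟨w, rfl⟩ := (mem_faces_iff.1 hF.1.1).2
  have hcF : Convex ℝ (face K w) := convex_face (convex_convexHull ℝ T) w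
  obtain ⟨b, hb⟩ : (relInterior (face K w)).Nonempty := by
    rw [hKdef, face_convexHull]
    refine relInterior_convexHull_nonempty (hT.subset Set.inter_subset_left) ?_
    rw [← convexHull_nonempty_iff (𝕜 := ℝ), ← face_convexHull]
    exact hF.1.1.1
  obtain ⟨f, hf, hfb⟩ := exists_supporting hcF hF.1.2 hb hnot
  let u := (InnerProductSpace.toDual ℝ X).symm (LinearMap.toContinuousLinearMap f)
  have hu : ∀ y, inner ℝ u y = f y := fun y => by simp [u]
  have hxu : x ∈ face (face K w) u := ⟨hF.1.2, fun y hy => by rw [hu, hu]; exact hf y hy⟩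
  obtain ⟨ε, hε, hε0⟩ := ((eventually_face_subset hT ⟨x, hxu⟩).and self_mem_nhdsWithin).exists
  have hε0 : 0 < ε := hε0
  have hx2 : x ∈ face K (w + ε • u) := hε hxu
  have hsum := face_add hF.1.2 hx2
  have hmem : face K (w + (w + ε • u)) ∈ {F | F ∈ faces K ∧ x ∈ F} := by
    have hxm : x ∈ face K (w + (w + ε • u)) := hsum ▸ ⟨hF.1.2, hx2⟩
    exact ⟨mem_faces_iff.2 ⟨⟨x, hxm⟩, _, rfl⟩, hxm⟩
  have hb2 : b ∈ face K (w + (w + ε • u)) :=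
    hF.le_of_le hmem (by rw [hsum]; exact Set.inter_subset_left) hb.1
  rw [hsum] at hb2
  have h1 := inner_eq_of_mem_face hb2.2 hx2
  have h2 := inner_eq_of_mem_face hb.1 hF.1.2
  rw [inner_add_left, inner_add_left, inner_smul_left, inner_smul_left, hu, hu, h2] at h1
  have : ε * f b = ε * f x := by simpa using h1
  nlinarith

/-- A functional maximal at a relative interior point of `F` cannot decrease towards any point of
`F`, since it would then increase along the prolongation. -/
theorem face_subset_of_relInterior {K F : Set X} {w x : X} (hFK : F ⊆ K) (hx : x ∈ relInterior F)
    (hxw : x ∈ face K w) : F ⊆ face K w := by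
  intro y hy
  obtain ⟨ε, hε, h⟩ := hx.2 y hy
  have h1 := hxw.2 _ (hFK h)
  have h2 := hxw.2 _ (hFK hy)
  rw [inner_add_right, inner_smul_right, inner_sub_right] at h1
  refine mem_face_of_inner_eq hxw (hFK hy) ?_
  nlinarith

theorem faces_subset {K F : Set X} (hF : F ∈ faces K) : F ⊆ K := hF.2.subset

theorem face_unique_of_relInterior [FiniteDimensional ℝ X] {K F F' : Set X} (hF : F ∈ faces K)
    (hF' : F' ∈ faces K) {x : X} (hx : x ∈ relInterior F) (hx' : x ∈ relInterior F') : F = F' := by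
  obtain ⟨-, w, hw⟩ := mem_faces_iff.1 hF
  obtain ⟨-, w', hw'⟩ := mem_faces_iff.1 hF'
  apply Set.Subset.antisymm
  · rw [hw']
    exact face_subset_of_relInterior (faces_subset hF) hx (hw' ▸ hx'.1)
  · rw [hw]
    exact face_subset_of_relInterior (faces_subset hF') hx' (hw ▸ hx.1)

theorem convex_of_mem_faces [FiniteDimensional ℝ X] {K F : Set X} (hK : Convex ℝ K)
    (hF : F ∈ faces K) : Convex ℝ F := by
  obtain ⟨-, w, rfl⟩ := mem_faces_iff.1 hF
  exact convex_face hK w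

theorem relInterior_face_nonempty [FiniteDimensional ℝ X] {T F : Set X} (hT : T.Finite)
    (hF : F ∈ faces (convexHull ℝ T)) : (relInterior F).Nonempty := by
  obtain ⟨hne, w, rfl⟩ := mem_faces_iff.1 hF
  rw [face_convexHull] at hne ⊢
  exact relInterior_convexHull_nonempty (hT.subset Set.inter_subset_left)
    (convexHull_nonempty_iff.1 hne)

/-- Euler's relation for polytopes. -/
theorem euler_relation [FiniteDimensional ℝ X] {T : Set X} (hT : T.Finite) (hne : T.Nonempty) :
    ∑ F ∈ (faces_finite hT).toFinset, (-1 : ℤ) ^ dim F = 1 := by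
  classical
  let L : X ≃ₗ[ℝ] (Fin (finrank ℝ X) → ℝ) := (finBasis ℝ X).equivFun
  have hLc : Continuous L := LinearMap.continuous_of_finiteDimensional L.toLinearMap
  have hK : IsCompact (L '' convexHull ℝ T) := (hT.isCompact_convexHull ℝ).image hLc
  have h1 : HasEulerIntegral ((L '' convexHull ℝ T).indicator 1) 1 :=
    hasEulerIntegral_compact hK ((convex_convexHull ℝ T).linear_image L.toLinearMap)
      (hne.convexHull.image _)
  obtain ⟨R, hR⟩ := hK.isBounded.exists_norm_le
  have h2 : ∀ F ∈ (faces_finite hT).toFinset,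
      HasEulerIntegral ((L '' relInterior F).indicator 1) ((-1) ^ dim F) := by
    intro F hF
    rw [Set.Finite.mem_toFinset] at hF
    have hc := convex_of_mem_faces (convex_convexHull ℝ T) hF
    have hne := relInterior_face_nonempty hT hF
    have hdim : dim F = finrank ℝ (vectorSpan ℝ (L '' relInterior F)) := by
      have h := AffineMap.map_vectorSpan (k := ℝ) L.toLinearMap.toAffineMap (s := relInterior F)
      have h' : vectorSpan ℝ (L '' relInterior F) =
        (vectorSpan ℝ (relInterior F)).map L.toLinearMap := h.symm
      rw [h', vectorSpan_relInterior hc hne]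
      exact (LinearEquiv.finrank_map_eq L _).symm
    rw [hdim]
    refine hasEulerIntegral_relOpen (R := R) ?_ ((convex_relInterior hc).linear_image L.toLinearMap)
      (hne.image _) ?_
    · rintro _ ⟨x, hx, rfl⟩ _ ⟨y, hy, rfl⟩
      obtain ⟨ε, hε, h⟩ := relOpen_relInterior hc x hx y hy
      exact ⟨ε, hε, _, h, by simp⟩
    · rintro _ ⟨x, hx, rfl⟩ i
      exact (norm_le_pi_norm (L x) i).trans (hR _ ⟨x, faces_subset hF hx.1, rfl⟩)
  have h3 := HasEulerIntegral.sum _ h2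
  -- The relative interiors of the faces partition the polytope.
  have h4 : (fun x => ∑ F ∈ (faces_finite hT).toFinset,
      (L '' relInterior F).indicator (1 : (Fin (finrank ℝ X) → ℝ) → ℤ) x) =
      (L '' convexHull ℝ T).indicator 1 := by
    funext z
    obtain ⟨x, rfl⟩ := L.surjective z
    have hm : ∀ S : Set X, (L x ∈ L '' S) ↔ x ∈ S := fun S => L.injective.mem_set_image
    simp only [Set.indicator_apply, hm, Pi.one_apply]
    split_ifs with hx
    · obtain ⟨F, hF, hxF⟩ := exists_mem_relInterior_face hT hx
      rw [Finset.sum_eq_single F]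
      · simp [hxF]
      · intro F' hF' hne
        rw [if_neg]
        intro h
        exact hne (face_unique_of_relInterior ((faces_finite hT).mem_toFinset.1 hF') hF h hxF)
      · intro h
        exact absurd ((faces_finite hT).mem_toFinset.2 hF) h
    · refine Finset.sum_eq_zero fun F hF => if_neg fun h => hx ?_
      exact faces_subset ((faces_finite hT).mem_toFinset.1 hF) h.1
  rw [h4] at h3
  exact h3.unique h1

/-! ### Dimensions and numbers of faces -/

theorem inner_eq_zero_of_mem_vectorSpan {K : Set X} {w v : X}
    (h : ∀ x ∈ K, ∀ y ∈ K, inner ℝ w x = inner ℝ w y) (hv : v ∈ vectorSpan ℝ K) :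
    inner ℝ w v = 0 := by
  unfold vectorSpan at hv
  induction hv using Submodule.span_induction with
  | mem v hv =>
    obtain ⟨x, hx, y, hy, rfl⟩ := hv
    simp [inner_sub_right, h x hx y hy]
  | zero => simp
  | add v w _ _ hv hw => rw [inner_add_right, hv, hw, add_zero]
  | smul a v _ hv => rw [inner_smul_right, hv, mul_zero]

theorem inner_eq_of_vectorSpan {K : Set X} {w : X} (h : ∀ v ∈ vectorSpan ℝ K, inner ℝ w v = 0)
    {x y : X} (hx : x ∈ K) (hy : y ∈ K) : inner ℝ w x = inner ℝ w y := by
  have := h _ (vsub_mem_vectorSpan ℝ hx hy)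
  rwa [vsub_eq_sub, inner_sub_right, sub_eq_zero] at this

variable [FiniteDimensional ℝ X]

theorem dim_mono {F K : Set X} (h : F ⊆ K) : dim F ≤ dim K :=
  Submodule.finrank_mono (vectorSpan_mono ℝ h)

theorem eq_of_dim_eq {K F : Set X} (hF : F ∈ faces K) (h : dim F = dim K) : F = K := by
  obtain ⟨⟨x, hx⟩, w, rfl⟩ := mem_faces_iff.1 hF
  have hs : vectorSpan ℝ (face K w) = vectorSpan ℝ K :=
    Submodule.eq_of_le_of_finrank_eq (vectorSpan_mono ℝ (face_subset K w)) h
  refine Set.Subset.antisymm (face_subset K w) fun y hy => mem_face_of_inner_eq hx hy ?_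
  refine inner_eq_of_vectorSpan (fun v hv => ?_) hx.1 hy
  rw [← hs] at hv
  exact inner_eq_zero_of_mem_vectorSpan (fun x hx y hy => inner_eq_of_mem_face hx hy) hv

theorem fVector_dim {K : Set X} (hne : K.Nonempty) : fVector K (dim K) = 1 := by
  have : {F | F ∈ faces K ∧ dim F = dim K} = {K} := by
    ext F
    constructor
    · rintro ⟨hF, h⟩
      exact eq_of_dim_eq hF h
    · rintro rfl
      exact ⟨mem_faces_iff.2 ⟨hne, 0, (face_zero _).symm⟩, rfl⟩
  rw [fVector, this, Set.ncard_singleton]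

theorem fVector_eq_zero {K : Set X} {i : ℕ} (hi : dim K < i) : fVector K i = 0 := by
  have : {F | F ∈ faces K ∧ dim F = i} = ∅ := by
    ext F
    simp only [Set.mem_empty_iff_false, iff_false]
    rintro ⟨hF, rfl⟩
    exact (dim_mono (faces_subset hF)).not_gt hi
  rw [fVector, this, Set.ncard_empty]

theorem euler_fVector {T : Set X} (hT : T.Finite) (hne : T.Nonempty) {n : ℕ}
    (hn : dim (convexHull ℝ T) < n) :
    ∑ i ∈ Finset.range n, (-1 : ℤ) ^ i * fVector (convexHull ℝ T) i = 1 := by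
  classical
  refine Eq.trans ?_ (euler_relation hT hne)
  rw [← Finset.sum_fiberwise_of_maps_to
    (s := (faces_finite hT).toFinset) (t := Finset.range n) (g := dim)]
  · refine Finset.sum_congr rfl fun i _ => ?_
    have h : ∀ F ∈ (faces_finite hT).toFinset.filter (fun F => dim F = i),
        (-1 : ℤ) ^ dim F = (-1) ^ i := fun F hF => by rw [(Finset.mem_filter.1 hF).2]
    rw [Finset.sum_congr rfl h, Finset.sum_const, nsmul_eq_mul, mul_comm]
    congr 2
    rw [fVector, ← Set.ncard_coe_finset]
    congr 1
    ext F
    simp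
  · intro F hF
    rw [Finset.mem_range]
    exact (dim_mono (faces_subset ((faces_finite hT).mem_toFinset.1 hF))).trans_lt hn

theorem dim_eq_zero_iff {F : Set X} : dim F = 0 ↔ F.Subsingleton := by
  rw [dim, Submodule.finrank_eq_zero, vectorSpan_eq_bot_iff_subsingleton]

/-- A polytope of dimension `k` has at least `k + 1` vertices. -/
theorem dim_lt_fVector_zero {T : Set X} (hT : T.Finite) (hne : T.Nonempty) :
    dim (convexHull ℝ T) < fVector (convexHull ℝ T) 0 := by
  classical
  set K := convexHull ℝ T
  have hfin : {F | F ∈ faces K ∧ dim F = 0}.Finite := (faces_finite hT).subset fun F hF => hF.1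
  -- The face with `x` in its relative interior is just `{x}`: a further point would put `x` inside
  -- a segment. By Krein–Milman the vertices then span the polytope.
  have hext : K.extremePoints ℝ ⊆ {x | {x} ∈ faces K} := by
    intro x hx
    obtain ⟨F, hF, hxF⟩ := exists_mem_relInterior_face hT hx.1
    have : F = {x} := by
      refine Set.eq_singleton_iff_unique_mem.2 ⟨hxF.1, fun y hy => ?_⟩
      obtain ⟨ε, hε, h⟩ := hxF.2 y hy
      refine hx.2 (faces_subset hF hy) (faces_subset hF h) ?_
      refine ⟨ε / (1 + ε), 1 / (1 + ε), by positivity, by positivity, by field_simp; ring, ?_⟩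
      have h1 : (1 + ε) ≠ 0 := by positivity
      have h2 : x = (1 / (1 + ε) * (1 + ε)) • x := by
        rw [one_div, inv_mul_cancel₀ h1, one_smul]
      nth_rewrite 3 [h2]
      have h3 : ε / (1 + ε) = 1 / (1 + ε) * ε := by ring
      rw [h3]
      module
    rw [Set.mem_ofPred_eq, ← this]
    exact hF
  let V := {x | {x} ∈ faces K}
  have hVfin : V.Finite :=
    Set.Finite.of_finite_image (f := fun x => ({x} : Set X))
      ((faces_finite hT).subset (by rintro _ ⟨x, hx, rfl⟩; exact hx))
      (Set.singleton_injective.injOn)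
  have hV : V.ncard ≤ fVector K 0 := by
    refine Set.ncard_le_ncard_of_injOn (fun x => ({x} : Set X)) (fun x hx => ⟨hx, ?_⟩)
      Set.singleton_injective.injOn hfin
    exact dim_eq_zero_iff.2 Set.subsingleton_singleton
  have hKV : K ⊆ convexHull ℝ V := by
    rw [← closure_convexHull_extremePoints (s := K) (hT.isCompact_convexHull ℝ) (convex_convexHull ℝ T)]
    exact closure_minimal (convexHull_mono hext) (hVfin.isCompact_convexHull ℝ).isClosed
  have hVne : V.Nonempty := by
    rw [← convexHull_nonempty_iff (𝕜 := ℝ)]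
    exact hne.convexHull.mono hKV
  refine lt_of_lt_of_le ?_ hV
  have h1 : dim K ≤ dim V := by
    refine (dim_mono hKV).trans_eq ?_
    unfold dim
    rw [← direction_affineSpan, affineSpan_convexHull, direction_affineSpan]
  refine h1.trans_lt ?_
  lift V to Finset X using hVfin with V' hV'
  rw [Set.ncard_coe_finset]
  obtain ⟨m, hm⟩ : ∃ m, V'.card = m + 1 :=
    Nat.exists_eq_succ_of_ne_zero (Finset.card_ne_zero.2 (by simpa using hVne))
  have := finrank_vectorSpan_image_finset_le ℝ (id : X → X) V' hm
  rw [Finset.image_id] at this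
  exact hm ▸ Nat.lt_succ_of_le this

end PolytopeFaces

/-! ### Finite reflection groups -/

section ReflectionGroups

open Filter Topology

variable {X : Type*} [NormedAddCommGroup X] [InnerProductSpace ℝ X]

theorem inner_map_eq_inner_inv (g : X ≃ₗᵢ[ℝ] X) (x y : X) :
    inner ℝ (g x) y = inner ℝ x (g⁻¹ y) := by
  have := g.inner_map_map x (g⁻¹ y)
  rwa [show g (g⁻¹ y) = y from g.apply_symm_apply y] at this

theorem inner_inv_map_eq_inner (g : X ≃ₗᵢ[ℝ] X) (x y : X) :
    inner ℝ (g⁻¹ x) y = inner ℝ x (g y) := by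
  rw [inner_map_eq_inner_inv, inv_inv]

variable [FiniteDimensional ℝ X]

/-- The normal vector of the hyperplane `H` that points to the side of `c`. -/
def normal (c : X) (H : Submodule ℝ X) : X := Hᗮ.starProjection c

/-- The open chamber around `c`. -/
def openChamber (ℋ : Set (Submodule ℝ X)) (c : X) : Set X :=
  {w | ∀ H ∈ ℋ, 0 < inner ℝ (normal c H) w}

/-- The closed chamber around `c`. -/
def closedChamber (ℋ : Set (Submodule ℝ X)) (c : X) : Set X :=
  {w | ∀ H ∈ ℋ, 0 ≤ inner ℝ (normal c H) w}

theorem openChamber_subset (ℋ : Set (Submodule ℝ X)) (c : X) :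
    openChamber ℋ c ⊆ closedChamber ℋ c := fun _ hw H hH => (hw H hH).le

theorem normal_mem (c : X) (H : Submodule ℝ X) : normal c H ∈ Hᗮ :=
  Submodule.starProjection_apply_mem _ _

theorem inner_normal_self (c : X) (H : Submodule ℝ X) :
    inner ℝ (normal c H) c = inner ℝ (normal c H) (normal c H) := by
  have h := Submodule.sub_starProjection_mem_orthogonal (K := Hᗮ) c
  have := (Submodule.mem_orthogonal _ _).1 h _ (normal_mem c H)
  rw [inner_sub_right, sub_eq_zero] at this
  exact this

theorem inner_normal_pos {c : X} {H : Submodule ℝ X} (hc : c ∉ H) :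
    0 < inner ℝ (normal c H) (normal c H) := by
  rw [real_inner_self_pos]
  intro h
  apply hc
  have h1 := Submodule.sub_starProjection_mem_orthogonal (K := Hᗮ) c
  rw [show Hᗮ.starProjection c = 0 from h, sub_zero, Submodule.orthogonal_orthogonal] at h1
  exact h1

theorem normal_ne_zero {c : X} {H : Submodule ℝ X} (hc : c ∉ H) : normal c H ≠ 0 :=
  real_inner_self_pos.1 (inner_normal_pos hc)

theorem inner_normal_center_pos {c : X} {H : Submodule ℝ X} (hc : c ∉ H) :
    0 < inner ℝ (normal c H) c := by
  rw [inner_normal_self]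
  exact inner_normal_pos hc

variable {ℋ : Set (Submodule ℝ X)} {c : X}

theorem center_mem_openChamber (hc : ∀ H ∈ ℋ, c ∉ H) : c ∈ openChamber ℋ c :=
  fun H hH => inner_normal_center_pos (hc H hH)

theorem orthogonal_eq_span_normal {H : Submodule ℝ X} (hH : finrank ℝ H + 1 = finrank ℝ X)
    (hc : c ∉ H) : Hᗮ = ℝ ∙ normal c H := by
  symm
  apply Submodule.eq_of_le_of_finrank_eq
  · rw [Submodule.span_singleton_le_iff_mem]
    exact normal_mem c H
  · rw [finrank_span_singleton (normal_ne_zero hc)]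
    have := H.finrank_add_finrank_orthogonal
    omega

theorem mem_iff_inner_normal {H : Submodule ℝ X} (hH : finrank ℝ H + 1 = finrank ℝ X)
    (hc : c ∉ H) {x : X} : x ∈ H ↔ inner ℝ (normal c H) x = 0 := by
  rw [← Submodule.mem_orthogonal_singleton_iff_inner_right, ← orthogonal_eq_span_normal hH hc,
    Submodule.orthogonal_orthogonal]

theorem reflection_eq {H : Submodule ℝ X} (hH : finrank ℝ H + 1 = finrank ℝ X)
    (hc : c ∉ H) (x : X) : H.reflection x =
      x - (2 * inner ℝ (normal c H) x / inner ℝ (normal c H) (normal c H)) • normal c H := by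
  have hn := inner_normal_pos hc
  set n := normal c H with hndef
  set a := inner ℝ n x / inner ℝ n n with ha
  have h1 : x - a • n ∈ H := by
    rw [mem_iff_inner_normal hH hc, inner_sub_right, inner_smul_right, ha,
      div_mul_cancel₀ _ hn.ne', sub_self]
  have h2 : x = (x - a • n) + a • n := by abel
  have h3 : H.reflection n = -n :=
    Submodule.reflection_mem_subspace_orthogonalComplement_eq_neg (normal_mem c H)
  nth_rewrite 1 [h2]
  rw [map_add, Submodule.reflection_mem_subspace_eq_self h1, map_smul, h3, mul_div_assoc, ← ha]
  module

theorem inner_normal_reflection (H : Submodule ℝ X) (x : X) :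
    inner ℝ (normal c H) (H.reflection x) = -inner ℝ (normal c H) x := by
  have h3 : H.reflection (normal c H) = -normal c H :=
    Submodule.reflection_mem_subspace_orthogonalComplement_eq_neg (normal_mem c H)
  have := H.reflection.inner_map_map (normal c H) x
  rw [h3, inner_neg_left] at this
  linarith

theorem reflection_mem_group {H : Submodule ℝ X} (hH : H ∈ ℋ) :
    H.reflection ∈ reflectionGroup ℋ := Subgroup.subset_closure ⟨H, hH, rfl⟩

theorem reflection_map_eq (g : X ≃ₗᵢ[ℝ] X) (H : Submodule ℝ X) :
    (H.map (g.toLinearEquiv : X →ₗ[ℝ] X)).reflection = g * H.reflection * g⁻¹ := by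
  ext x
  rw [Submodule.reflection_map_apply]
  rfl

theorem reflection_eq_conj {g : X ≃ₗᵢ[ℝ] X} {H K : Submodule ℝ X}
    (hK : H.map (g.toLinearEquiv : X →ₗ[ℝ] X) = K) :
    K.reflection = g * H.reflection * g⁻¹ := by
  subst hK
  exact reflection_map_eq g H

theorem IsReflectionArrangement.map_mem (h : IsReflectionArrangement ℋ) {g : X ≃ₗᵢ[ℝ] X}
    (hg : g ∈ reflectionGroup ℋ) {H : Submodule ℝ X} (hH : H ∈ ℋ) :
    H.map (g.toLinearEquiv : X →ₗ[ℝ] X) ∈ ℋ := by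
  apply h.mem_of_reflection_mem
  · rw [LinearEquiv.finrank_map_eq]
    exact h.hyperplane H hH
  · rw [reflection_map_eq]
    exact mul_mem (mul_mem hg (reflection_mem_group hH)) (inv_mem hg)

/-- The group permutes the mirrors and hence the normal lines. The sign of the scalar tells whether
`g` respects the sides of `c`; the normals are not normalized, so the scalar is left free. -/
theorem exists_map_normal (h : IsReflectionArrangement ℋ) (hc : ∀ H ∈ ℋ, c ∉ H)
    {g : X ≃ₗᵢ[ℝ] X} (hg : g ∈ reflectionGroup ℋ) {H : Submodule ℝ X} (hH : H ∈ ℋ) :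
    ∃ a : ℝ, g (normal c H) = a • normal c (H.map (g.toLinearEquiv : X →ₗ[ℝ] X)) := by
  have hm := h.map_mem hg hH
  have h1 : g (normal c H) ∈ (H.map (g.toLinearEquiv : X →ₗ[ℝ] X))ᗮ := by
    rw [Submodule.mem_orthogonal]
    rintro _ ⟨x, hx, rfl⟩
    change inner ℝ (g x) (g (normal c H)) = 0
    rw [g.inner_map_map]
    exact (Submodule.mem_orthogonal _ _).1 (normal_mem c H) x hx
  rw [orthogonal_eq_span_normal (h.hyperplane _ hm) (hc _ hm), Submodule.mem_span_singleton] at h1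
  obtain ⟨a, ha⟩ := h1
  exact ⟨a, ha.symm⟩

/-- Every vector can be moved by a finite group containing the reflections of `S` to the positive
side of all members of `S`. -/
theorem exists_fold (h : IsReflectionArrangement ℋ) (hc : ∀ H ∈ ℋ, c ∉ H)
    {S : Set (Submodule ℝ X)} (hS : S ⊆ ℋ) {Γ : Subgroup (X ≃ₗᵢ[ℝ] X)}
    (hΓ : (Γ : Set (X ≃ₗᵢ[ℝ] X)).Finite) (hSΓ : ∀ H ∈ S, H.reflection ∈ Γ) (w : X) :
    ∃ g ∈ Γ, ∀ H ∈ S, 0 ≤ inner ℝ (normal c H) (g w) := by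
  -- Reflecting a point from the negative side of a mirror increases its product with `c`, so a
  -- maximizer lies on no negative side.
  obtain ⟨g, hg, hmax⟩ := Set.exists_max_image _ (fun g : X ≃ₗᵢ[ℝ] X => inner ℝ c (g w)) hΓ
    ⟨1, one_mem Γ⟩
  refine ⟨g, hg, fun H hH => ?_⟩
  by_contra hneg
  push Not at hneg
  have h1 := hmax (H.reflection * g) (mul_mem (hSΓ H hH) hg)
  have h2 : (H.reflection * g) w = H.reflection (g w) := rfl
  rw [h2, reflection_eq (h.hyperplane H (hS hH)) (hc H (hS hH)), inner_sub_right,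
    inner_smul_right, real_inner_comm (normal c H) c] at h1
  have h3 : 2 * inner ℝ (normal c H) (g w) / inner ℝ (normal c H) (normal c H) < 0 :=
    div_neg_of_neg_of_pos (by linarith) (inner_normal_pos (hc H (hS hH)))
  have h4 := inner_normal_center_pos (hc H (hS hH))
  nlinarith

/-! ### Walls of a chamber and the exchange condition -/

theorem eventually_pos_add_smul {S : Set (Submodule ℝ X)} (hS : S.Finite) {w : X}
    (hw : ∀ H ∈ S, 0 < inner ℝ (normal c H) w) (z : X) :
    ∀ᶠ ε in 𝓝[>] (0 : ℝ), ∀ H ∈ S, 0 < inner ℝ (normal c H) (w + ε • z) := by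
  refine (eventually_all_finite hS).2 fun H hH => ?_
  have hcont : Continuous fun ε : ℝ => inner ℝ (normal c H) (w + ε • z) := by fun_prop
  have : ∀ᶠ ε in 𝓝 (0 : ℝ), 0 < inner ℝ (normal c H) (w + ε • z) :=
    hcont.continuousAt.eventually (Ioi_mem_nhds (by simpa using hw H hH))
  exact this.filter_mono nhdsWithin_le_nhds

/-- `S` is an irredundant set of hyperplanes which bound the chamber of `c`. -/
structure IsWalls (ℋ : Set (Submodule ℝ X)) (c : X) (S : Set (Submodule ℝ X)) : Prop where
  subset : S ⊆ ℋ
  mem_closedChamber : ∀ w, (∀ H ∈ S, 0 ≤ inner ℝ (normal c H) w) → w ∈ closedChamber ℋ c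
  exists_point : ∀ H ∈ S, ∃ w, inner ℝ (normal c H) w = 0 ∧
    ∀ K ∈ ℋ, K ≠ H → 0 < inner ℝ (normal c K) w

/-- The walls are a minimal subset of `ℋ` that still cuts out the closed chamber. -/
theorem exists_isWalls (h : IsReflectionArrangement ℋ) (hc : ∀ H ∈ ℋ, c ∉ H) :
    ∃ S, IsWalls ℋ c S := by
  have hfin : {S | S ⊆ ℋ ∧ ∀ w, (∀ H ∈ S, 0 ≤ inner ℝ (normal c H) w) →
      w ∈ closedChamber ℋ c}.Finite := h.finite.finite_subsets.subset fun S hS => hS.1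
  obtain ⟨S, hS⟩ := hfin.exists_minimal ⟨ℋ, subset_rfl, fun w hw => hw⟩
  refine ⟨S, hS.1.1, hS.1.2, fun H hH => ?_⟩
  have hHℋ := hS.1.1 hH
  have hnot : ¬ ∀ w, (∀ K ∈ S \ {H}, 0 ≤ inner ℝ (normal c K) w) → w ∈ closedChamber ℋ c := by
    intro hall
    have := hS.le_of_le (y := S \ {H}) ⟨Set.sdiff_subset.trans hS.1.1, hall⟩ Set.sdiff_subset hH
    exact this.2 rfl
  push Not at hnot
  obtain ⟨w, hw, hwc⟩ := hnot
  have hwH : inner ℝ (normal c H) w < 0 := by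
    by_contra hge
    push Not at hge
    refine hwc (hS.1.2 w fun K hK => ?_)
    by_cases hKH : K = H
    · exact hKH ▸ hge
    · exact hw K ⟨hK, hKH⟩
  have hcH := inner_normal_center_pos (hc H hHℋ)
  -- Up to a positive factor, the point where the segment from `c` to `w` crosses `H`.
  set w' := (-inner ℝ (normal c H) w) • c + inner ℝ (normal c H) c • w with hw'
  have hw'H : inner ℝ (normal c H) w' = 0 := by
    rw [hw', inner_add_right, inner_smul_right, inner_smul_right]
    ring
  have hw'S : ∀ K ∈ S \ {H}, 0 < inner ℝ (normal c K) w' := by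
    intro K hK
    rw [hw', inner_add_right, inner_smul_right, inner_smul_right]
    have h1 := mul_pos (neg_pos.2 hwH) (inner_normal_center_pos (hc K (hS.1.1 hK.1)))
    have h2 := mul_nonneg hcH.le (hw K hK)
    linarith
  have hw'c : w' ∈ closedChamber ℋ c := hS.1.2 _ fun K hK => by
    by_cases hKH : K = H
    · rw [hKH, hw'H]
    · exact (hw'S K ⟨hK, hKH⟩).le
  refine ⟨w', hw'H, fun K hK hKH => (hw'c K hK).lt_of_ne' fun h0 => ?_⟩
  -- If `w'` were on another mirror `K`, a short step inside `H` to the negative side of `K` would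
  -- violate no condition of `S`, yet leave the chamber.
  obtain ⟨z, hzH, hzK⟩ : ∃ z ∈ H, inner ℝ (normal c K) z < 0 := by
    by_contra hall
    push Not at hall
    refine hKH (Submodule.eq_of_le_of_finrank_eq (fun z hz => ?_) ?_).symm
    · rw [mem_iff_inner_normal (h.hyperplane K hK) (hc K hK)]
      have h1 := hall z hz
      have h2 := hall (-z) (neg_mem hz)
      rw [inner_neg_right] at h2
      linarith
    · have h1 := h.hyperplane K hK
      have h2 := h.hyperplane H hHℋ
      omega
  obtain ⟨ε, hε, hε0⟩ := ((eventually_pos_add_smul (h.finite.subset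
    (Set.sdiff_subset.trans hS.1.1)) hw'S z).and self_mem_nhdsWithin).exists
  have hε0 : 0 < ε := hε0
  have hmem : w' + ε • z ∈ closedChamber ℋ c := hS.1.2 _ fun K' hK' => by
    by_cases hKH' : K' = H
    · rw [hKH', inner_add_right, inner_smul_right, hw'H,
        (mem_iff_inner_normal (h.hyperplane H hHℋ) (hc H hHℋ)).1 hzH]
      simp
    · exact (hε K' ⟨hK', hKH'⟩).le
  have := hmem K hK
  rw [inner_add_right, inner_smul_right, h0] at this
  nlinarith

/-- A wall is the only hyperplane that separates a chamber from its mirror image in the wall. -/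
theorem IsWalls.reflection_pos {S : Set (Submodule ℝ X)} (hS : IsWalls ℋ c S)
    (h : IsReflectionArrangement ℋ) (hc : ∀ H ∈ ℋ, c ∉ H) {H K : Submodule ℝ X} (hH : H ∈ S)
    (hK : K ∈ ℋ) (hKH : K ≠ H) {x : X} (hx : x ∈ openChamber ℋ c) :
    0 < inner ℝ (normal c K) (H.reflection x) := by
  have hHr := reflection_mem_group (hS.subset hH)
  obtain ⟨a, ha⟩ := exists_map_normal h hc hHr hK
  obtain ⟨w, hwH, hw⟩ := hS.exists_point H hH
  have hK' := h.map_mem hHr hK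
  set K' := K.map (H.reflection.toLinearEquiv : X →ₗ[ℝ] X)
  have key : ∀ y, inner ℝ (normal c K) (H.reflection y) = a * inner ℝ (normal c K') y := by
    intro y
    rw [← real_inner_smul_left, ← ha, inner_map_eq_inner_inv, Submodule.reflection_inv]
  have hwfix : H.reflection w = w := Submodule.reflection_mem_subspace_eq_self
    ((mem_iff_inner_normal (h.hyperplane H (hS.subset hH)) (hc H (hS.subset hH))).2 hwH)
  have h1 := key w
  rw [hwfix] at h1
  -- The sign of `a` is read off at `w`, which the reflection fixes.
  have h2 := hw K hK hKH
  have h3 : 0 ≤ inner ℝ (normal c K') w := by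
    by_cases hKK : K' = H
    · rw [hKK, hwH]
    · exact (hw K' hK' hKK).le
  have ha0 : 0 < a := by
    by_contra hneg
    push Not at hneg
    nlinarith [mul_nonneg (neg_nonneg.2 hneg) h3]
  rw [key]
  exact mul_pos ha0 (hx K' hK')

/-- The product of the reflections in a list of hyperplanes. -/
def word (L : List (Submodule ℝ X)) : X ≃ₗᵢ[ℝ] X := (L.map fun H => H.reflection).prod

theorem word_mem {S : Set (Submodule ℝ X)} {Γ : Subgroup (X ≃ₗᵢ[ℝ] X)}
    (hS : ∀ H ∈ S, H.reflection ∈ Γ) {L : List (Submodule ℝ X)} (hL : ∀ H ∈ L, H ∈ S) :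
    word L ∈ Γ := by
  refine list_prod_mem fun g hg => ?_
  obtain ⟨H, hH, rfl⟩ := List.mem_map.1 hg
  exact hS H (hL H hH)

theorem inner_normal_map_ne_zero (h : IsReflectionArrangement ℋ) (hc : ∀ H ∈ ℋ, c ∉ H)
    {g : X ≃ₗᵢ[ℝ] X} (hg : g ∈ reflectionGroup ℋ) {H : Submodule ℝ X} (hH : H ∈ ℋ) {x : X}
    (hx : x ∈ openChamber ℋ c) : inner ℝ (normal c H) (g x) ≠ 0 := by
  have hm := h.map_mem (inv_mem hg) hH
  obtain ⟨a, ha⟩ := exists_map_normal h hc (inv_mem hg) hH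
  rw [← inner_inv_map_eq_inner, ha, real_inner_smul_left]
  refine mul_ne_zero ?_ (hx _ hm).ne'
  rintro rfl
  rw [zero_smul, map_eq_zero_iff _ (g⁻¹).injective] at ha
  exact normal_ne_zero (hc H hH) ha

/-- The exchange condition. -/
theorem IsWalls.exchange {S : Set (Submodule ℝ X)} (hS : IsWalls ℋ c S)
    (h : IsReflectionArrangement ℋ) (hc : ∀ H ∈ ℋ, c ∉ H) {H : Submodule ℝ X} (hH : H ∈ S)
    {x : X} (hx : x ∈ openChamber ℋ c) (L : List (Submodule ℝ X)) (hL : ∀ K ∈ L, K ∈ S)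
    (hneg : inner ℝ (normal c H) (word L x) < 0) :
    ∃ L' : List (Submodule ℝ X), (∀ K ∈ L', K ∈ S) ∧ L'.length + 1 = L.length ∧
      word L = H.reflection * word L' := by
  have hSr : ∀ K ∈ S, K.reflection ∈ reflectionGroup ℋ :=
    fun K hK => reflection_mem_group (hS.subset hK)
  induction L using List.reverseRecOn with
  | nil => exact absurd hneg (hx H (hS.subset hH)).not_gt
  | append_singleton L K ih =>
    have hKS : K ∈ S := hL K (by simp)
    have hLS : ∀ K ∈ L, K ∈ S := fun K' hK' => hL K' (by simp [hK'])
    have hw : word (L ++ [K]) = word L * K.reflection := by simp [word]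
    have hpm := word_mem hSr hLS
    rcases lt_or_gt_of_ne (inner_normal_map_ne_zero h hc hpm (hS.subset hH) hx) with h1 | h1
    · obtain ⟨L', hL', hlen, he⟩ := ih hLS h1
      refine ⟨L' ++ [K], ?_, by simp [hlen], ?_⟩
      · intro K' hK'
        rcases List.mem_append.1 hK' with h2 | h2
        · exact hL' K' h2
        · rw [List.mem_singleton.1 h2]
          exact hKS
      · rw [hw, he]
        simp [word, mul_assoc]
    · refine ⟨L, hLS, by simp, ?_⟩
      set p := word L
      have hm := h.map_mem (inv_mem hpm) (hS.subset hH)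
      obtain ⟨a, ha⟩ := exists_map_normal h hc (inv_mem hpm) (hS.subset hH)
      set H' := H.map ((p⁻¹).toLinearEquiv : X →ₗ[ℝ] X)
      have key : ∀ y, inner ℝ (normal c H) (p y) = a * inner ℝ (normal c H') y := fun y => by
        rw [← real_inner_smul_left, ← ha, inner_inv_map_eq_inner]
      rw [hw, show (p * K.reflection) x = p (K.reflection x) from rfl, key] at hneg
      rw [key] at h1
      have ha0 : 0 < a := pos_of_mul_pos_left h1 (hx _ hm).le
      -- The prefix `p` keeps `x` on the positive side of `H`, so the last letter effects the
      -- crossing; reflection in the wall `K` changes the side of no mirror but `K`. The conjugation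
      -- relation then lets the last letter be dropped.
      have hHK : H' = K := by
        by_contra hne
        exact (mul_pos ha0 (hS.reflection_pos h hc hKS hm hne hx)).not_gt hneg
      rw [hw, reflection_eq_conj hHK]
      group

/-- If a nonempty word returns `x` to the chamber, the word without its first letter `H` puts `x` on
the negative side of `H`; exchange then yields an equal word shorter by two letters. -/
theorem IsWalls.word_eq_one {S : Set (Submodule ℝ X)} (hS : IsWalls ℋ c S)
    (h : IsReflectionArrangement ℋ) (hc : ∀ H ∈ ℋ, c ∉ H) {x : X} (hx : x ∈ openChamber ℋ c) :
    ∀ (n : ℕ) (L : List (Submodule ℝ X)), L.length = n → (∀ K ∈ L, K ∈ S) →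
      word L x ∈ openChamber ℋ c → word L = 1 := by
  intro n
  induction n using Nat.strong_induction_on with
  | _ n ih =>
    intro L hn hL hmem
    cases L with
    | nil => rfl
    | cons H L =>
      have hHS : H ∈ S := hL H (by simp)
      have hw : word (H :: L) = H.reflection * word L := by simp [word]
      have hw' : word L = H.reflection * word (H :: L) := by
        rw [hw, ← mul_assoc, Submodule.reflection_mul_reflection, one_mul]
      have hneg : inner ℝ (normal c H) (word L x) < 0 := by
        rw [hw', show (H.reflection * word (H :: L)) x = H.reflection (word (H :: L) x) from rfl,
          inner_normal_reflection, neg_lt_zero]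
        exact hmem H (hS.subset hHS)
      obtain ⟨L', hL', hlen, he⟩ := hS.exchange h hc hHS hx L
        (fun K hK => hL K (by simp [hK])) hneg
      have hwL : word (H :: L) = word L' := by
        rw [hw, he, ← mul_assoc, Submodule.reflection_mul_reflection, one_mul]
      rw [hwL] at hmem ⊢
      exact ih L'.length (by simp at hn; omega) L' rfl hL' hmem

theorem finite_reflectionGroup (h : IsReflectionArrangement ℋ) :
    (reflectionGroup ℋ : Set (X ≃ₗᵢ[ℝ] X)).Finite :=
  have := h.finite_group
  Set.toFinite _

/-- The reflections in the walls of a chamber generate the group. -/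
theorem IsWalls.closure_eq {S : Set (Submodule ℝ X)} (hS : IsWalls ℋ c S)
    (h : IsReflectionArrangement ℋ) (hc : ∀ H ∈ ℋ, c ∉ H) :
    reflectionGroup S = reflectionGroup ℋ := by
  have hle : reflectionGroup S ≤ reflectionGroup ℋ := by
    refine Subgroup.closure_mono ?_
    rintro _ ⟨H, hH, rfl⟩
    exact ⟨H, hS.subset hH, rfl⟩
  refine le_antisymm hle ((Subgroup.closure_le _).2 ?_)
  rintro _ ⟨H, hH, rfl⟩
  -- A generic point of `H` avoids all other mirrors, as a real vector space is not a finite union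
  -- of proper subspaces. Folding it into the closed chamber by wall reflections carries `H` to a
  -- wall.
  obtain ⟨w, hwH, hw⟩ : ∃ w ∈ H, ∀ K ∈ ℋ, w ∈ K → K = H := by
    have hfin : {M : Submodule ℝ H | ∃ K ∈ ℋ, K ≠ H ∧ M = K.comap H.subtype}.Finite := by
      refine (h.finite.image fun K => K.comap H.subtype).subset ?_
      rintro _ ⟨K, hK, -, rfl⟩
      exact ⟨K, hK, rfl⟩
    have htop : (⊤ : Submodule ℝ H) ∉ hfin.toFinset := by
      rw [Set.Finite.mem_toFinset]
      rintro ⟨K, hK, hne, heq⟩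
      refine hne (Submodule.eq_of_le_of_finrank_eq ?_ ?_).symm
      · rwa [eq_comm, Submodule.comap_subtype_eq_top] at heq
      · have h1 := h.hyperplane K hK
        have h2 := h.hyperplane H hH
        omega
    have hne := Subspace.biUnion_ne_univ_of_top_notMem htop
    obtain ⟨w, hw⟩ := (Set.ne_univ_iff_exists_notMem _).1 hne
    refine ⟨w, w.2, fun K hK hwK => ?_⟩
    by_contra hKH
    refine hw (Set.mem_iUnion₂.2 ⟨K.comap H.subtype, ?_, hwK⟩)
    exact hfin.mem_toFinset.2 ⟨K, hK, hKH, rfl⟩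
  obtain ⟨g, hg, hgw⟩ := exists_fold h hc hS.subset
    ((finite_reflectionGroup h).subset hle) (fun K hK => reflection_mem_group hK) w
  have hgG := hle hg
  have hgH := h.map_mem hgG hH
  -- Otherwise a neighbourhood of `g w` would lie in the chamber, although the mirror `g H` passes
  -- through `g w`.
  obtain ⟨K, hK, hK0⟩ : ∃ K ∈ S, inner ℝ (normal c K) (g w) = 0 := by
    by_contra hall
    push Not at hall
    have hpos : ∀ K ∈ S, 0 < inner ℝ (normal c K) (g w) :=
      fun K hK => (hgw K hK).lt_of_ne' (hall K hK)
    set H' := H.map (g.toLinearEquiv : X →ₗ[ℝ] X)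
    obtain ⟨ε, hε, hε0⟩ := ((eventually_pos_add_smul (h.finite.subset hS.subset) hpos
      (-normal c H')).and self_mem_nhdsWithin).exists
    have hε0 : 0 < ε := hε0
    have h1 := hS.mem_closedChamber _ (fun K hK => (hε K hK).le) H' hgH
    have h2 : inner ℝ (normal c H') (g w) = 0 :=
      (mem_iff_inner_normal (h.hyperplane _ hgH) (hc _ hgH)).1 ⟨w, hwH, rfl⟩
    rw [inner_add_right, inner_smul_right, inner_neg_right, h2] at h1
    have := mul_pos hε0 (inner_normal_pos (hc _ hgH))
    linarith
  have hKℋ := hS.subset hK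
  have h1 : g w ∈ K := (mem_iff_inner_normal (h.hyperplane _ hKℋ) (hc _ hKℋ)).2 hK0
  have h2 : K.map ((g⁻¹).toLinearEquiv : X →ₗ[ℝ] X) = H :=
    hw _ (h.map_mem (inv_mem hgG) hKℋ) ⟨g w, h1, g.symm_apply_apply w⟩
  change H.reflection ∈ reflectionGroup S
  rw [reflection_eq_conj h2]
  exact mul_mem (mul_mem (inv_mem hg) (reflection_mem_group hK)) (inv_mem (inv_mem hg))

theorem exists_word {S : Set (Submodule ℝ X)} {g : X ≃ₗᵢ[ℝ] X} (hg : g ∈ reflectionGroup S) :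
    ∃ L : List (Submodule ℝ X), (∀ K ∈ L, K ∈ S) ∧ word L = g := by
  unfold reflectionGroup at hg
  induction hg using Subgroup.closure_induction with
  | mem g hg =>
    obtain ⟨H, hH, rfl⟩ := hg
    exact ⟨[H], by simpa using hH, by simp [word]⟩
  | one => exact ⟨[], by simp, rfl⟩
  | mul g g' _ _ hg hg' =>
    obtain ⟨L, hL, rfl⟩ := hg
    obtain ⟨L', hL', rfl⟩ := hg'
    refine ⟨L ++ L', fun K hK => ?_, by simp [word]⟩
    exact (List.mem_append.1 hK).elim (hL K) (hL' K)
  | inv g _ hg =>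
    obtain ⟨L, hL, rfl⟩ := hg
    refine ⟨L.reverse, fun K hK => hL K (List.mem_reverse.1 hK), ?_⟩
    rw [word, word, List.prod_inv_reverse, List.map_map, List.map_reverse]
    congr 3

/-- The group acts freely on the points off the mirrors, and each chamber is a fundamental
domain. -/
theorem eq_one_of_mem_openChamber (h : IsReflectionArrangement ℋ) (hc : ∀ H ∈ ℋ, c ∉ H)
    {g : X ≃ₗᵢ[ℝ] X} (hg : g ∈ reflectionGroup ℋ) {x : X} (hx : x ∈ openChamber ℋ c)
    (hgx : g x ∈ openChamber ℋ c) : g = 1 := by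
  obtain ⟨S, hS⟩ := exists_isWalls h hc
  rw [← hS.closure_eq h hc] at hg
  obtain ⟨L, hL, rfl⟩ := exists_word hg
  exact hS.word_eq_one h hc hx _ L rfl hL hgx

/-! ### Chamber functionals on orbits -/

theorem inner_reflection_eq (h : IsReflectionArrangement ℋ) (hc : ∀ H ∈ ℋ, c ∉ H)
    {H : Submodule ℝ X} (hH : H ∈ ℋ) {y : X} (hy : inner ℝ (normal c H) y < 0) :
    ∃ a : ℝ, 0 < a ∧ ∀ w, inner ℝ w (H.reflection y) = inner ℝ w y + a * inner ℝ (normal c H) w := by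
  refine ⟨-(2 * inner ℝ (normal c H) y / inner ℝ (normal c H) (normal c H)), ?_, fun w => ?_⟩
  · rw [neg_pos]
    exact div_neg_of_neg_of_pos (by linarith) (inner_normal_pos (hc H hH))
  · rw [reflection_eq (h.hyperplane H hH) (hc H hH), inner_sub_right, inner_smul_right,
      real_inner_comm w (normal c H)]
    ring

theorem exists_neg_of_ne_one (h : IsReflectionArrangement ℋ) (hc : ∀ H ∈ ℋ, c ∉ H)
    {g : X ≃ₗᵢ[ℝ] X} (hg : g ∈ reflectionGroup ℋ) (hne : g ≠ 1) {x : X}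
    (hx : x ∈ openChamber ℋ c) : ∃ H ∈ ℋ, inner ℝ (normal c H) (g x) < 0 := by
  by_contra hall
  push Not at hall
  exact hne (eq_one_of_mem_openChamber h hc hg hx fun H hH =>
    (hall H hH).lt_of_ne' (inner_normal_map_ne_zero h hc hg hH hx))

/-- Among the counterexamples `k` take one with the largest product of `c` and `k x`. As `k ≠ 1`,
some mirror has `k x` on its negative side; reflecting there does not lower the product with `w` and
raises that with `c`. -/
theorem inner_map_le (h : IsReflectionArrangement ℋ) (hc : ∀ H ∈ ℋ, c ∉ H)
    {g : X ≃ₗᵢ[ℝ] X} (hg : g ∈ reflectionGroup ℋ) {x w : X} (hx : x ∈ openChamber ℋ c)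
    (hw : w ∈ closedChamber ℋ c) : inner ℝ w (g x) ≤ inner ℝ w x := by
  by_contra hbad
  push Not at hbad
  obtain ⟨k, ⟨hk, hkw⟩, hmax⟩ := Set.exists_max_image
    {g | g ∈ reflectionGroup ℋ ∧ inner ℝ w x < inner ℝ w (g x)} (fun g => inner ℝ c (g x))
    ((finite_reflectionGroup h).subset fun g hg => hg.1) ⟨g, hg, hbad⟩
  have hne : k ≠ 1 := by
    rintro rfl
    exact lt_irrefl _ hkw
  obtain ⟨H, hH, hneg⟩ := exists_neg_of_ne_one h hc hk hne hx
  obtain ⟨a, ha, hr⟩ := inner_reflection_eq h hc hH hneg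
  have h1 := hmax (H.reflection * k) ⟨mul_mem (reflection_mem_group hH) hk, by
    rw [show (H.reflection * k) x = H.reflection (k x) from rfl, hr]
    have := mul_nonneg ha.le (hw H hH)
    linarith⟩
  rw [show (H.reflection * k) x = H.reflection (k x) from rfl, hr] at h1
  have := mul_pos ha (inner_normal_center_pos (hc H hH))
  linarith

/-- An element of the group which preserves the value of a functional `w` of the closed chamber at
a point of the open chamber is a product of reflections fixing `w`. -/
theorem mem_closure_of_inner_map_eq (h : IsReflectionArrangement ℋ) (hc : ∀ H ∈ ℋ, c ∉ H)
    {g : X ≃ₗᵢ[ℝ] X} (hg : g ∈ reflectionGroup ℋ) {x w : X} (hx : x ∈ openChamber ℋ c)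
    (hw : w ∈ closedChamber ℋ c) (heq : inner ℝ w (g x) = inner ℝ w x) :
    g ∈ reflectionGroup {H | H ∈ ℋ ∧ w ∈ H} := by
  by_contra hbad
  obtain ⟨k, ⟨hk, hkw, hkn⟩, hmax⟩ := Set.exists_max_image
    {g | g ∈ reflectionGroup ℋ ∧ inner ℝ w (g x) = inner ℝ w x ∧
      g ∉ reflectionGroup {H | H ∈ ℋ ∧ w ∈ H}} (fun g => inner ℝ c (g x))
    ((finite_reflectionGroup h).subset fun g hg => hg.1) ⟨g, hg, heq, hbad⟩
  have hne : k ≠ 1 := by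
    rintro rfl
    exact hkn (one_mem _)
  obtain ⟨H, hH, hneg⟩ := exists_neg_of_ne_one h hc hk hne hx
  obtain ⟨a, ha, hr⟩ := inner_reflection_eq h hc hH hneg
  have hm := mul_mem (reflection_mem_group hH) hk
  have happ : (H.reflection * k) x = H.reflection (k x) := rfl
  have h1 := inner_map_le h hc hm hx hw
  rw [happ, hr, hkw] at h1
  -- `k x` already attains the upper bound for `w`, so the reflection cannot raise it: the mirror
  -- contains `w`, and multiplying by its reflection keeps the element a counterexample.
  have h2 : inner ℝ (normal c H) w = 0 :=
    le_antisymm (by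
      by_contra hpos
      push Not at hpos
      have := mul_pos ha hpos
      linarith) (hw H hH)
  have hwH : w ∈ H := (mem_iff_inner_normal (h.hyperplane H hH) (hc H hH)).2 h2
  have h3 := hmax (H.reflection * k) ⟨hm, by rw [happ, hr, hkw, h2, mul_zero, add_zero],
    fun hmem => hkn (by
      have hHw : H.reflection ∈ reflectionGroup {H | H ∈ ℋ ∧ w ∈ H} :=
        reflection_mem_group (show H ∈ {H | H ∈ ℋ ∧ w ∈ H} from ⟨hH, hwH⟩)
      exact (Subgroup.mul_mem_cancel_left _ hHw).1 hmem)⟩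
  rw [happ, hr] at h3
  have := mul_pos ha (inner_normal_center_pos (hc H hH))
  linarith

theorem apply_eq_of_mem_closure {w : X} {g : X ≃ₗᵢ[ℝ] X}
    (hg : g ∈ reflectionGroup {H | H ∈ ℋ ∧ w ∈ H}) : g w = w := by
  unfold reflectionGroup at hg
  induction hg using Subgroup.closure_induction with
  | mem g hg =>
    obtain ⟨H, hH, rfl⟩ := hg
    exact Submodule.reflection_mem_subspace_eq_self hH.2
  | one => rfl
  | mul g g' _ _ hg hg' => rw [show (g * g') w = g (g' w) from rfl, hg', hg]
  | inv g _ hg =>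
    nth_rewrite 1 [← hg]
    exact g.symm_apply_apply w

end ReflectionGroups

/-! ### Symmetrizations and their faces -/

section SymmetrizationFaces

open Filter Topology

variable {X : Type*} [NormedAddCommGroup X] [InnerProductSpace ℝ X]

/-- The functionals of the chamber that are maximal on `face P w` and vanish wherever `w` does. -/
def fanCone (ℋ : Set (Submodule ℝ X)) (Φ P : Set X) (w : X) : Set X :=
  {w' | w' ∈ Φ ∧ face P w ⊆ face P w' ∧ ∀ H ∈ ℋ, w ∈ H → w' ∈ H}

/-- All functionals which are maximal over `P` on `F`. -/
def maxCone (F P : Set X) : Set X :=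
  {w | ∀ y ∈ F, ∀ y' ∈ P, inner ℝ w y' ≤ inner ℝ w y}

/-- The fan of all nonempty faces of the intersections of `Φ` with the normal cones of `P`. -/
def chamberFan (Φ P : Set X) : Set (Set X) :=
  {τ | ∃ F ∈ faces P, τ ∈ faces (maxCone F P ∩ Φ)}

theorem image_face (K : Set X) (g : X ≃ₗᵢ[ℝ] X) (w : X) :
    g '' face K w = face (g '' K) (g w) := by
  ext y
  constructor
  · rintro ⟨x, hx, rfl⟩
    refine ⟨⟨x, hx.1, rfl⟩, ?_⟩
    rintro _ ⟨z, hz, rfl⟩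
    rw [g.inner_map_map, g.inner_map_map]
    exact hx.2 z hz
  · rintro ⟨⟨x, hx, rfl⟩, h⟩
    refine ⟨x, ⟨hx, fun z hz => ?_⟩, rfl⟩
    have := h _ ⟨z, hz, rfl⟩
    rwa [g.inner_map_map, g.inner_map_map] at this

theorem dim_image (g : X ≃ₗᵢ[ℝ] X) (F : Set X) : dim (g '' F) = dim F := by
  have h := AffineMap.map_vectorSpan (k := ℝ) (g.toLinearEquiv : X →ₗ[ℝ] X).toAffineMap (s := F)
  have h' : vectorSpan ℝ (g '' F) = (vectorSpan ℝ F).map (g.toLinearEquiv : X →ₗ[ℝ] X) := h.symm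
  rw [dim, dim, h']
  exact LinearEquiv.finrank_map_eq g.toLinearEquiv _

theorem maxCone_face {P : Set X} {w w' : X} : w' ∈ maxCone (face P w) P ↔
    face P w ⊆ face P w' :=
  ⟨fun h x hx => ⟨hx.1, fun y hy => h x hx y hy⟩, fun h _ hy y' hy' => (h hy).2 y' hy'⟩

variable [FiniteDimensional ℝ X] {ℋ : Set (Submodule ℝ X)} {c : X} {T : Set X}

/-- The union of the images of `T` under the reflection group. -/
def orbitSet (ℋ : Set (Submodule ℝ X)) (T : Set X) : Set X :=
  {y | ∃ g ∈ reflectionGroup ℋ, ∃ x ∈ T, y = g x}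

theorem orbitSet_finite (h : IsReflectionArrangement ℋ) (hT : T.Finite) :
    (orbitSet ℋ T).Finite := by
  refine ((finite_reflectionGroup h).image2 (fun g x => g x) hT).subset ?_
  rintro _ ⟨g, hg, x, hx, rfl⟩
  exact ⟨g, hg, x, hx, rfl⟩

theorem subset_orbitSet (ℋ : Set (Submodule ℝ X)) (T : Set X) : T ⊆ orbitSet ℋ T :=
  fun x hx => ⟨1, one_mem _, x, hx, rfl⟩

theorem hull_subset_hull_orbitSet (ℋ : Set (Submodule ℝ X)) (T : Set X) :
    convexHull ℝ T ⊆ convexHull ℝ (orbitSet ℋ T) := convexHull_mono (subset_orbitSet ℋ T)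

theorem image_hull_orbitSet {g : X ≃ₗᵢ[ℝ] X} (hg : g ∈ reflectionGroup ℋ) :
    g '' convexHull ℝ (orbitSet ℋ T) = convexHull ℝ (orbitSet ℋ T) := by
  have key : ∀ {g : X ≃ₗᵢ[ℝ] X}, g ∈ reflectionGroup ℋ →
      g '' convexHull ℝ (orbitSet ℋ T) ⊆ convexHull ℝ (orbitSet ℋ T) := by
    intro g hg
    have := (g.toLinearEquiv : X →ₗ[ℝ] X).image_convexHull (orbitSet ℋ T)
    rw [show g '' convexHull ℝ (orbitSet ℋ T) = convexHull ℝ (g '' orbitSet ℋ T) from this]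
    refine convexHull_mono ?_
    rintro _ ⟨_, ⟨k, hk, x, hx, rfl⟩, rfl⟩
    exact ⟨g * k, mul_mem hg hk, x, hx, rfl⟩
  refine Set.Subset.antisymm (key hg) fun y hy => ?_
  exact ⟨g⁻¹ y, key (inv_mem hg) ⟨y, hy, rfl⟩, g.apply_symm_apply y⟩

theorem image_face_orbitSet {g : X ≃ₗᵢ[ℝ] X} (hg : g ∈ reflectionGroup ℋ) (w : X) :
    g '' face (convexHull ℝ (orbitSet ℋ T)) w = face (convexHull ℝ (orbitSet ℋ T)) (g w) := by
  rw [image_face, image_hull_orbitSet hg]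

/-- The standing assumptions: `ℋ` is a reflection arrangement, `c` is on none of its members and
the convex hull of the nonempty finite set `T` is contained in the open chamber of `c`. -/
structure IsSetup (ℋ : Set (Submodule ℝ X)) (c : X) (T : Set X) : Prop where
  arr : IsReflectionArrangement ℋ
  center : ∀ H ∈ ℋ, c ∉ H
  finite : T.Finite
  nonempty : T.Nonempty
  subset : convexHull ℝ T ⊆ openChamber ℋ c

theorem IsSetup.face_nonempty (hs : IsSetup ℋ c T) (w : X) : (face (convexHull ℝ T) w).Nonempty :=
  PolytopeSymmetrization.face_nonempty (hs.finite.isCompact_convexHull ℝ) hs.nonempty.convexHull w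

theorem IsSetup.map_mem_face (hs : IsSetup ℋ c T) {w x : X} (hw : w ∈ closedChamber ℋ c)
    (hx : x ∈ face (convexHull ℝ T) w) {g : X ≃ₗᵢ[ℝ] X} (hg : g ∈ reflectionGroup ℋ)
    (hgw : g w = w) : g x ∈ face (convexHull ℝ (orbitSet ℋ T)) w := by
  have hx' : x ∈ face (convexHull ℝ (orbitSet ℋ T)) w := by
    refine ⟨hull_subset_hull_orbitSet ℋ T hx.1, fun y hy => ?_⟩
    refine inner_le_of_mem_convexHull ?_ hy
    rintro _ ⟨k, hk, t, ht, rfl⟩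
    have ht' := subset_convexHull ℝ T ht
    exact (inner_map_le hs.arr hs.center hk (hs.subset ht') hw).trans (hx.2 t ht')
  rw [← hgw, ← image_face_orbitSet hg]
  exact ⟨x, hx', rfl⟩

theorem IsSetup.face_subset_face (hs : IsSetup ℋ c T) {w : X} (hw : w ∈ closedChamber ℋ c) :
    face (convexHull ℝ T) w ⊆ face (convexHull ℝ (orbitSet ℋ T)) w :=
  fun _ hx => hs.map_mem_face hw hx (one_mem _) rfl

theorem mem_face_of_mem_face_orbitSet {w x : X}
    (hx : x ∈ face (convexHull ℝ (orbitSet ℋ T)) w) (hxP : x ∈ convexHull ℝ T) :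
    x ∈ face (convexHull ℝ T) w :=
  ⟨hxP, fun y hy => hx.2 y (hull_subset_hull_orbitSet ℋ T hy)⟩

/-- If `g t` maximizes `w`, then its value, that at `t` and the maximum over the polytope all agree;
the equality case then applies to `g`. -/
theorem IsSetup.exists_of_mem_face (hs : IsSetup ℋ c T) {w y : X} (hw : w ∈ closedChamber ℋ c) (hy : y ∈ orbitSet ℋ T)
    (hyf : y ∈ face (convexHull ℝ (orbitSet ℋ T)) w) :
    ∃ g ∈ reflectionGroup {H | H ∈ ℋ ∧ w ∈ H}, g ∈ reflectionGroup ℋ ∧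
      ∃ x ∈ face (convexHull ℝ T) w, y = g x := by
  obtain ⟨g, hg, t, ht, rfl⟩ := hy
  have ht' := subset_convexHull ℝ T ht
  obtain ⟨z, hz⟩ := hs.face_nonempty w
  have h1 := inner_map_le hs.arr hs.center hg (hs.subset ht') hw
  have h2 := hz.2 t ht'
  have h3 := hyf.2 z (hull_subset_hull_orbitSet ℋ T hz.1)
  exact ⟨g, mem_closure_of_inner_map_eq hs.arr hs.center hg (hs.subset ht') hw (by linarith), hg,
    t, mem_face_of_inner_eq hz ht' (by linarith), rfl⟩

/-- The face contains a point of the open chamber and its mirror image in `H`; they differ by a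
positive multiple of the normal. -/
theorem IsSetup.normal_mem_vectorSpan (hs : IsSetup ℋ c T) {w : X} (hw : w ∈ closedChamber ℋ c) {H : Submodule ℝ X}
    (hH : H ∈ ℋ) (hwH : w ∈ H) :
    normal c H ∈ vectorSpan ℝ (face (convexHull ℝ (orbitSet ℋ T)) w) := by
  obtain ⟨x, hx⟩ := hs.face_nonempty w
  have h1 := hs.map_mem_face hw hx (reflection_mem_group hH)
    (Submodule.reflection_mem_subspace_eq_self hwH)
  have h2 := vsub_mem_vectorSpan ℝ (hs.face_subset_face hw hx) h1
  rw [vsub_eq_sub, reflection_eq (hs.arr.hyperplane H hH) (hs.center H hH), sub_sub_cancel] at h2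
  have hpos : 0 < 2 * inner ℝ (normal c H) x / inner ℝ (normal c H) (normal c H) :=
    div_pos (by linarith [hs.subset hx.1 H hH]) (inner_normal_pos (hs.center H hH))
  have h3 := Submodule.smul_mem _
    (2 * inner ℝ (normal c H) x / inner ℝ (normal c H) (normal c H))⁻¹ h2
  rwa [smul_smul, inv_mul_cancel₀ hpos.ne', one_smul] at h3

/-- The face of the symmetrization is generated from `face P w` by the reflections fixing `w`. So
`w'` is maximal on it exactly when it is maximal on `face P w` and lies on the mirrors through `w`.
-/
theorem IsSetup.fanCone_eq (hs : IsSetup ℋ c T) {w : X} (hw : w ∈ closedChamber ℋ c) :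
    fanCone ℋ (closedChamber ℋ c) (convexHull ℝ T) w =
      {w' | w' ∈ closedChamber ℋ c ∧ face (convexHull ℝ (orbitSet ℋ T)) w ⊆
        face (convexHull ℝ (orbitSet ℋ T)) w'} := by
  ext w'
  constructor
  · rintro ⟨hw', hsub, hH⟩
    refine ⟨hw', ?_⟩
    rw [face_convexHull]
    refine convexHull_min ?_ (convex_face (convex_convexHull ℝ _) _)
    rintro y ⟨hy, hyf⟩
    obtain ⟨g, hg, hgG, x, hx, rfl⟩ := hs.exists_of_mem_face hw hy hyf
    refine hs.map_mem_face hw' (hsub hx) hgG ?_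
    have hle : reflectionGroup {H | H ∈ ℋ ∧ w ∈ H} ≤ reflectionGroup {H | H ∈ ℋ ∧ w' ∈ H} := by
      refine Subgroup.closure_mono ?_
      rintro _ ⟨H, hH', rfl⟩
      exact ⟨H, ⟨hH'.1, hH H hH'.1 hH'.2⟩, rfl⟩
    exact apply_eq_of_mem_closure (hle hg)
  · rintro ⟨hw', hsub⟩
    refine ⟨hw', fun x hx => mem_face_of_mem_face_orbitSet
      (hsub (hs.face_subset_face hw hx)) hx.1, fun H hH hwH => ?_⟩
    rw [mem_iff_inner_normal (hs.arr.hyperplane H hH) (hs.center H hH), real_inner_comm]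
    exact inner_eq_zero_of_mem_vectorSpan
      (fun x hx y hy => inner_eq_of_mem_face (hsub hx) (hsub hy))
      (hs.normal_mem_vectorSpan hw hH hwH)

theorem mem_fanCone_self {w : X} (hw : w ∈ closedChamber ℋ c) :
    w ∈ fanCone ℋ (closedChamber ℋ c) (convexHull ℝ T) w :=
  ⟨hw, subset_rfl, fun _ _ h => h⟩

/-- This makes `w` a relative interior point of its cone. Mirrors through `w` impose nothing on the
step, because their normals lie in the direction of the face; the remaining conditions are strict at
`w`. -/
theorem IsSetup.exists_add_smul_mem_fanCone (hs : IsSetup ℋ c T) {w u : X} (hw : w ∈ closedChamber ℋ c)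
    (hu : ∀ v ∈ vectorSpan ℝ (face (convexHull ℝ (orbitSet ℋ T)) w), inner ℝ u v = 0) :
    ∃ ε : ℝ, 0 < ε ∧ w + ε • u ∈ fanCone ℋ (closedChamber ℋ c) (convexHull ℝ T) w := by
  set Q := convexHull ℝ (orbitSet ℋ T)
  obtain ⟨x, hx⟩ := hs.face_nonempty w
  have hxQ := hs.face_subset_face hw hx
  have hfu : face (face Q w) u = face Q w :=
    Set.Subset.antisymm (face_subset _ _) fun y hy =>
      ⟨hy, fun z hz => (inner_eq_of_vectorSpan hu hz hy).le⟩
  have h1 := eventually_face_subset (u := u) (w := w) (orbitSet_finite hs.arr hs.finite)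
    (by change (face (face Q w) u).Nonempty; rw [hfu]; exact ⟨x, hxQ⟩)
  change ∀ᶠ ε in 𝓝[>] (0 : ℝ), face (face Q w) u ⊆ face Q (w + ε • u) at h1
  rw [hfu] at h1
  have h2 := eventually_pos_add_smul (c := c) (S := {H | H ∈ ℋ ∧ w ∉ H})
    (hs.arr.finite.subset fun H hH => hH.1) (fun H hH => (hw H hH.1).lt_of_ne' fun h0 =>
      hH.2 ((mem_iff_inner_normal (hs.arr.hyperplane H hH.1) (hs.center H hH.1)).2 h0)) u
  obtain ⟨ε, ⟨hε1, hε2⟩, hε0⟩ := ((h1.and h2).and self_mem_nhdsWithin).exists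
  refine ⟨ε, hε0, ?_⟩
  rw [hs.fanCone_eq hw]
  refine ⟨fun H hH => ?_, hε1⟩
  by_cases hwH : w ∈ H
  · have hn := hu _ (hs.normal_mem_vectorSpan hw hH hwH)
    rw [inner_add_right, inner_smul_right, real_inner_comm u, hn,
      (mem_iff_inner_normal (hs.arr.hyperplane H hH) (hs.center H hH)).1 hwH]
    simp
  · exact (hε2 H ⟨hH, hwH⟩).le

theorem IsSetup.inner_eq_zero_of_mem_fanCone (hs : IsSetup ℋ c T) {w w' v : X} (hw : w ∈ closedChamber ℋ c)
    (hw' : w' ∈ fanCone ℋ (closedChamber ℋ c) (convexHull ℝ T) w)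
    (hv : v ∈ vectorSpan ℝ (face (convexHull ℝ (orbitSet ℋ T)) w)) : inner ℝ w' v = 0 := by
  rw [hs.fanCone_eq hw] at hw'
  exact inner_eq_zero_of_mem_vectorSpan
    (fun x hx y hy => inner_eq_of_mem_face (hw'.2 hx) (hw'.2 hy)) hv

theorem IsSetup.dim_fanCone (hs : IsSetup ℋ c T) {w : X} (hw : w ∈ closedChamber ℋ c) :
    dim (fanCone ℋ (closedChamber ℋ c) (convexHull ℝ T) w) +
      dim (face (convexHull ℝ (orbitSet ℋ T)) w) = finrank ℝ X := by
  have key : vectorSpan ℝ (fanCone ℋ (closedChamber ℋ c) (convexHull ℝ T) w) =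
      (vectorSpan ℝ (face (convexHull ℝ (orbitSet ℋ T)) w))ᗮ := by
    apply le_antisymm
    · rw [vectorSpan_eq_span_vsub_set_right ℝ (mem_fanCone_self hw), Submodule.span_le]
      rintro _ ⟨w', hw', rfl⟩
      refine (Submodule.mem_orthogonal' _ _).2 fun v hv => ?_
      change inner ℝ (w' - w) v = 0
      rw [inner_sub_left, hs.inner_eq_zero_of_mem_fanCone hw hw' hv,
        hs.inner_eq_zero_of_mem_fanCone hw (mem_fanCone_self hw) hv, sub_zero]
    · intro u hu
      obtain ⟨ε, hε, hmem⟩ := hs.exists_add_smul_mem_fanCone hw (u := u)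
        ((Submodule.mem_orthogonal' _ _).1 hu)
      have h1 := vsub_mem_vectorSpan ℝ hmem (mem_fanCone_self hw)
      rw [vsub_eq_sub, add_sub_cancel_left] at h1
      have h2 := Submodule.smul_mem _ ε⁻¹ h1
      rwa [smul_smul, inv_mul_cancel₀ hε.ne', one_smul] at h2
  rw [dim, dim, key, add_comm]
  exact Submodule.finrank_add_finrank_orthogonal _

theorem IsSetup.chamberFan_eq (hs : IsSetup ℋ c T) : chamberFan (closedChamber ℋ c) (convexHull ℝ T) =
    {τ | ∃ w ∈ closedChamber ℋ c, τ = fanCone ℋ (closedChamber ℋ c) (convexHull ℝ T) w} := by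
  set P := convexHull ℝ T
  set Φ := closedChamber ℋ c
  ext τ
  constructor
  · rintro ⟨F, hF, hτ⟩
    obtain ⟨hFne, w₁, rfl⟩ := mem_faces_iff.1 hF
    obtain ⟨hne, u, rfl⟩ := mem_faces_iff.1 hτ
    set C := maxCone (face P w₁) P ∩ Φ
    have hCconv : Convex ℝ C := by
      intro a ha b hb s t hs0 ht0 _
      refine ⟨fun y hy y' hy' => ?_, fun H hH => ?_⟩
      · rw [inner_add_left, inner_add_left, real_inner_smul_left, real_inner_smul_left,
          real_inner_smul_left, real_inner_smul_left]
        exact add_le_add (mul_le_mul_of_nonneg_left (ha.1 y hy y' hy') hs0)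
          (mul_le_mul_of_nonneg_left (hb.1 y hy y' hy') ht0)
      · rw [inner_add_right, inner_smul_right, inner_smul_right]
        exact add_nonneg (mul_nonneg hs0 (ha.2 H hH)) (mul_nonneg ht0 (hb.2 H hH))
    have hCsmul : ∀ a ∈ C, ∀ s : ℝ, 0 ≤ s → s • a ∈ C := by
      intro a ha s hs0
      refine ⟨fun y hy y' hy' => ?_, fun H hH => ?_⟩
      · rw [real_inner_smul_left, real_inner_smul_left]
        exact mul_le_mul_of_nonneg_left (ha.1 y hy y' hy') hs0
      · rw [inner_smul_right]
        exact mul_nonneg hs0 (ha.2 H hH)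
    have hτconv : Convex ℝ (face C u) := convex_face hCconv u
    -- A cone of the fan is the `fanCone` of any of its relative interior points.
    obtain ⟨w₀, hw₀⟩ : (relInterior (face C u)).Nonempty := by
      obtain ⟨z, hz⟩ := hne.intrinsicInterior hτconv
      exact ⟨z, mem_relInterior_of_mem_intrinsicInterior hz⟩
    have hw₀C : w₀ ∈ C := hw₀.1.1
    have hu0 : inner ℝ u w₀ = 0 := by
      have h1 := hw₀.1.2 _ (hCsmul w₀ hw₀C 0 le_rfl)
      have h2 := hw₀.1.2 _ (hCsmul w₀ hw₀C 2 zero_le_two)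
      rw [inner_smul_right] at h1 h2
      linarith
    have hFsub : face P w₁ ⊆ face P w₀ := maxCone_face.1 hw₀C.1
    have hconeC : fanCone ℋ Φ P w₀ ⊆ C := fun w' hw' =>
      ⟨maxCone_face.2 (hFsub.trans hw'.2.1), hw'.1⟩
    refine ⟨w₀, hw₀C.2, Set.Subset.antisymm ?_ ?_⟩
    · intro w' hw'
      obtain ⟨ε, hε, hmem⟩ := hw₀.2 w' hw'
      refine ⟨hw'.1.2, fun y hy => ⟨hy.1, fun z hz => ?_⟩, fun H hH hwH => ?_⟩
      · obtain ⟨y₀, hy₀⟩ := hFne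
        have h1 := hmem.1.1 y₀ hy₀ y hy.1
        rw [inner_add_left, inner_add_left, real_inner_smul_left, real_inner_smul_left,
          inner_sub_left, inner_sub_left, inner_eq_of_mem_face hy (hFsub hy₀)] at h1
        have h2 := hw'.1.1 y₀ hy₀ z hz
        have h3 : inner ℝ w' y₀ ≤ inner ℝ w' y := by
          by_contra hlt
          push Not at hlt
          nlinarith
        exact h2.trans h3
      · have hyp := hs.arr.hyperplane H hH
        have hcH := hs.center H hH
        rw [mem_iff_inner_normal hyp hcH] at hwH ⊢
        have h1 := hmem.1.2 H hH
        rw [inner_add_right, inner_smul_right, inner_sub_right, hwH] at h1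
        have h2 := hw'.1.2 H hH
        nlinarith
    · intro w' hw'
      refine mem_face_of_inner_eq hw₀.1 (hconeC hw') ?_
      rw [hu0]
      have h1 := hw₀.1.2 _ (hconeC hw')
      -- Stepping from `w₀` along `-w'` stays in the cone, which excludes a negative value of `u` at
      -- `w'`.
      obtain ⟨ε, hε, hmem⟩ := hs.exists_add_smul_mem_fanCone (u := -w') hw₀C.2 (fun v hv => by
        rw [inner_neg_left, hs.inner_eq_zero_of_mem_fanCone hw₀C.2 hw' hv, neg_zero])
      have h2 := hw₀.1.2 _ (hconeC hmem)
      rw [inner_add_right, inner_smul_right, inner_neg_right, hu0] at h2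
      rw [hu0] at h1
      nlinarith
  · rintro ⟨w, hw, rfl⟩
    -- Minus the sum of the normals of the mirrors through `w` is nonpositive on the chamber and
    -- vanishes exactly where all these normals do.
    refine ⟨face P w, mem_faces_iff.2 ⟨hs.face_nonempty w, w, rfl⟩, mem_faces_iff.2
      ⟨⟨w, mem_fanCone_self hw⟩, -∑ H ∈ (hs.arr.finite.subset
        (fun H (hH : H ∈ {H | H ∈ ℋ ∧ w ∈ H}) => hH.1)).toFinset, normal c H, ?_⟩⟩
    set S := (hs.arr.finite.subset
        (fun H (hH : H ∈ {H | H ∈ ℋ ∧ w ∈ H}) => hH.1)).toFinset with hS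
    have hSm : ∀ H, H ∈ S ↔ H ∈ ℋ ∧ w ∈ H := fun H => Set.Finite.mem_toFinset _
    have hin : ∀ v, inner ℝ (-∑ H ∈ S, normal c H) v = -∑ H ∈ S, inner ℝ (normal c H) v :=
      fun v => by rw [inner_neg_left, sum_inner]
    have hw0 : ∑ H ∈ S, inner ℝ (normal c H) w = 0 := Finset.sum_eq_zero fun H hH =>
      (mem_iff_inner_normal (hs.arr.hyperplane H ((hSm H).1 hH).1)
        (hs.center H ((hSm H).1 hH).1)).1 ((hSm H).1 hH).2
    ext w'
    constructor
    · rintro ⟨hw', hsub, hH⟩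
      refine ⟨⟨maxCone_face.2 hsub, hw'⟩, fun v hv => ?_⟩
      have hw0' : ∑ H ∈ S, inner ℝ (normal c H) w' = 0 := Finset.sum_eq_zero fun H hHS =>
        (mem_iff_inner_normal (hs.arr.hyperplane H ((hSm H).1 hHS).1)
          (hs.center H ((hSm H).1 hHS).1)).1 (hH H ((hSm H).1 hHS).1 ((hSm H).1 hHS).2)
      rw [hin, hin, hw0', neg_zero, neg_nonpos]
      exact Finset.sum_nonneg fun H hHS => hv.2 H ((hSm H).1 hHS).1
    · rintro ⟨⟨hmax, hw'⟩, hle⟩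
      refine ⟨hw', maxCone_face.1 hmax, fun H hH hwH => ?_⟩
      have h1 := hle w ⟨maxCone_face.2 subset_rfl, hw⟩
      rw [hin, hin, hw0, neg_zero, neg_nonneg] at h1
      have h2 := (Finset.sum_eq_zero_iff_of_nonneg
        (fun H hHS => hw' H ((hSm H).1 hHS).1)).1 (le_antisymm h1
          (Finset.sum_nonneg fun H hHS => hw' H ((hSm H).1 hHS).1))
      exact (mem_iff_inner_normal (hs.arr.hyperplane H hH) (hs.center H hH)).2
        (h2 H ((hSm H).2 ⟨hH, hwH⟩))

/-- The faces of the symmetrization which are selected by functionals of the chamber. -/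
def chamberFaces (ℋ : Set (Submodule ℝ X)) (c : X) (T : Set X) (i : ℕ) : Set (Set X) :=
  {F | (∃ w ∈ closedChamber ℋ c, F = face (convexHull ℝ (orbitSet ℋ T)) w) ∧ dim F = i}

theorem IsSetup.fanNumber_eq (hs : IsSetup ℋ c T) (i : ℕ) :
    fanNumber (chamberFan (closedChamber ℋ c) (convexHull ℝ T)) i =
      (chamberFaces ℋ c T i).ncard := by
  unfold fanNumber
  symm
  have hinj : ∀ {w w'}, w ∈ closedChamber ℋ c → w' ∈ closedChamber ℋ c →
      fanCone ℋ (closedChamber ℋ c) (convexHull ℝ T) w =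
        fanCone ℋ (closedChamber ℋ c) (convexHull ℝ T) w' →
      face (convexHull ℝ (orbitSet ℋ T)) w ⊆ face (convexHull ℝ (orbitSet ℋ T)) w' := by
    intro w w' hw hw' he
    have := mem_fanCone_self (T := T) hw'
    rw [← he, hs.fanCone_eq hw] at this
    exact this.2
  refine Set.ncard_congr
    (fun F _ => {w' | w' ∈ closedChamber ℋ c ∧ F ⊆ face (convexHull ℝ (orbitSet ℋ T)) w'})
    ?_ ?_ ?_
  · rintro _ ⟨⟨w, hw, rfl⟩, hi⟩
    rw [← hs.fanCone_eq hw, hs.chamberFan_eq]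
    refine ⟨⟨w, hw, rfl⟩, ?_⟩
    rw [← hi, hs.dim_fanCone hw]
  · rintro _ _ ⟨⟨w, hw, rfl⟩, -⟩ ⟨⟨w', hw', rfl⟩, -⟩ he
    simp only [← hs.fanCone_eq hw, ← hs.fanCone_eq hw'] at he
    exact Set.Subset.antisymm (hinj hw hw' he) (hinj hw' hw he.symm)
  · rintro τ ⟨hτ, hi⟩
    rw [hs.chamberFan_eq] at hτ
    obtain ⟨w, hw, rfl⟩ := hτ
    refine ⟨face (convexHull ℝ (orbitSet ℋ T)) w, ⟨⟨w, hw, rfl⟩, ?_⟩, (hs.fanCone_eq hw).symm⟩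
    have := hs.dim_fanCone hw
    omega

end SymmetrizationFaces

/-! ### Counting the faces of a symmetrization -/

section Counting

variable {X : Type*} [NormedAddCommGroup X] [InnerProductSpace ℝ X]

theorem mul_image (g g' : X ≃ₗᵢ[ℝ] X) (F : Set X) : (g * g') '' F = g '' (g' '' F) := by
  rw [Set.image_image]
  rfl

/-- Counting a union of orbits of sets whose stabilizers have the same order. -/
theorem ncard_orbits {G : Subgroup (X ≃ₗᵢ[ℝ] X)} (hG : (G : Set (X ≃ₗᵢ[ℝ] X)).Finite)
    {𝒜 : Set (Set X)} (h𝒜 : 𝒜.Finite) {m : ℕ}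
    (h1 : ∀ F ∈ 𝒜, ∀ F' ∈ 𝒜, ∀ g ∈ G, g '' F = F' → F = F')
    (h2 : ∀ F ∈ 𝒜, {g : X ≃ₗᵢ[ℝ] X | g ∈ G ∧ g '' F = F}.ncard = m) :
    m * {F' | ∃ g ∈ G, ∃ F ∈ 𝒜, F' = g '' F}.ncard = (G : Set (X ≃ₗᵢ[ℝ] X)).ncard * 𝒜.ncard := by
  classical
  let f : (X ≃ₗᵢ[ℝ] X) × Set X → Set X := fun p => p.1 '' p.2
  have himg : {F' | ∃ g ∈ G, ∃ F ∈ 𝒜, F' = g '' F} =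
      ((hG.toFinset ×ˢ h𝒜.toFinset).image f : Finset (Set X)) := by
    ext F'
    simp only [Finset.coe_image, Finset.coe_product, Set.Finite.coe_toFinset]
    constructor
    · rintro ⟨g, hg, F, hF, rfl⟩
      exact ⟨(g, F), ⟨hg, hF⟩, rfl⟩
    · rintro ⟨⟨g, F⟩, ⟨hg, hF⟩, rfl⟩
      exact ⟨g, hg, F, hF, rfl⟩
  rw [himg, Set.ncard_coe_finset, Set.ncard_eq_toFinset_card _ hG,
    Set.ncard_eq_toFinset_card _ h𝒜, ← Finset.card_product,
    Finset.card_eq_sum_card_image f (hG.toFinset ×ˢ h𝒜.toFinset),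
    Finset.sum_const_nat (m := m), mul_comm]
  -- The fibre of `(g, F) ↦ g '' F` over `g₀ '' F₀` is the coset of the stabilizer of `F₀` by `g₀`,
  -- paired with `F₀`.
  intro F' hF'
  obtain ⟨⟨g₀, F₀⟩, hp, rfl⟩ := Finset.mem_image.1 hF'
  simp only [Finset.mem_product, Set.Finite.mem_toFinset] at hp
  obtain ⟨hg₀, hF₀⟩ := hp
  rw [← h2 F₀ hF₀, ← Set.ncard_coe_finset]
  symm
  refine Set.ncard_congr (fun g _ => (g₀ * g, F₀)) ?_ ?_ ?_
  · rintro g ⟨hg, hgF⟩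
    simp only [Finset.coe_filter, Finset.mem_product, Set.Finite.mem_toFinset]
    refine ⟨⟨mul_mem hg₀ hg, hF₀⟩, ?_⟩
    change (g₀ * g) '' F₀ = g₀ '' F₀
    rw [mul_image, hgF]
  · intro g g' _ _ he
    exact mul_left_cancel (Prod.ext_iff.1 he).1
  · rintro ⟨g, F⟩ hgF
    simp only [Finset.coe_filter, Finset.mem_product, Set.Finite.mem_toFinset] at hgF
    obtain ⟨⟨hg, hF⟩, he⟩ := hgF
    have he : g '' F = g₀ '' F₀ := he
    have he' : (g₀⁻¹ * g) '' F = F₀ := by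
      rw [mul_image, he, ← mul_image, inv_mul_cancel]
      exact Set.image_id _
    have hFF : F = F₀ := h1 F hF F₀ hF₀ _ (mul_mem (inv_mem hg₀) hg) he'
    subst hFF
    exact ⟨g₀⁻¹ * g, ⟨mul_mem (inv_mem hg₀) hg, he'⟩, by rw [mul_inv_cancel_left]⟩

variable [FiniteDimensional ℝ X] {ℋ : Set (Submodule ℝ X)} {c : X} {T : Set X}

/-- For `x` in the face of the polytope at `w'`, the point `g⁻¹ x` maximizes `w` over the
symmetrization, so the equality case makes `g⁻¹` fix `w`. Hence chamber faces in one orbit coincide.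
-/
theorem IsSetup.apply_eq_of_face_eq (hs : IsSetup ℋ c T) {w w' : X} (hw : w ∈ closedChamber ℋ c)
    (hw' : w' ∈ closedChamber ℋ c) {g : X ≃ₗᵢ[ℝ] X} (hg : g ∈ reflectionGroup ℋ)
    (he : g '' face (convexHull ℝ (orbitSet ℋ T)) w = face (convexHull ℝ (orbitSet ℋ T)) w') :
    g w = w := by
  obtain ⟨x, hx⟩ := hs.face_nonempty w'
  obtain ⟨y, hy, hyx⟩ := he.symm ▸ hs.face_subset_face hw' hx
  have hy' : y = g⁻¹ x := by
    rw [← hyx]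
    exact (g.symm_apply_apply y).symm
  subst hy'
  have h1 := inner_map_le hs.arr hs.center (inv_mem hg) (hs.subset hx.1) hw
  have h2 := hy.2 x (hull_subset_hull_orbitSet ℋ T hx.1)
  have h3 := apply_eq_of_mem_closure (mem_closure_of_inner_map_eq hs.arr hs.center (inv_mem hg)
    (hs.subset hx.1) hw (le_antisymm h1 h2))
  nth_rewrite 1 [← h3]
  exact g.apply_symm_apply w

theorem IsSetup.faces_finite (hs : IsSetup ℋ c T) :
    (faces (convexHull ℝ (orbitSet ℋ T))).Finite :=
  PolytopeSymmetrization.faces_finite (orbitSet_finite hs.arr hs.finite)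

theorem IsSetup.chamberFaces_subset (hs : IsSetup ℋ c T) (i : ℕ) : chamberFaces ℋ c T i ⊆
    {F | F ∈ faces (convexHull ℝ (orbitSet ℋ T)) ∧ dim F = i} := by
  rintro _ ⟨⟨w, hw, rfl⟩, hi⟩
  obtain ⟨x, hx⟩ := hs.face_nonempty w
  exact ⟨mem_faces_iff.2 ⟨⟨x, hs.face_subset_face hw hx⟩, w, rfl⟩, hi⟩

theorem IsSetup.chamberFaces_finite (hs : IsSetup ℋ c T) (i : ℕ) :
    (chamberFaces ℋ c T i).Finite :=
  hs.faces_finite.subset fun _ hF => (hs.chamberFaces_subset i hF).1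

theorem IsSetup.eq_of_image_eq (hs : IsSetup ℋ c T) {i : ℕ} {F F' : Set X}
    (hF : F ∈ chamberFaces ℋ c T i) (hF' : F' ∈ chamberFaces ℋ c T i) {g : X ≃ₗᵢ[ℝ] X}
    (hg : g ∈ reflectionGroup ℋ) (he : g '' F = F') : F = F' := by
  obtain ⟨⟨w, hw, rfl⟩, -⟩ := hF
  obtain ⟨⟨w', hw', rfl⟩, -⟩ := hF'
  rw [← he, image_face_orbitSet hg, hs.apply_eq_of_face_eq hw hw' hg he]

/-- Every face of the symmetrization is the image of a face belonging to the chamber. -/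
theorem IsSetup.faces_eq (hs : IsSetup ℋ c T) (i : ℕ) :
    {F | F ∈ faces (convexHull ℝ (orbitSet ℋ T)) ∧ dim F = i} =
      {F' | ∃ g ∈ reflectionGroup ℋ, ∃ F ∈ chamberFaces ℋ c T i, F' = g '' F} := by
  ext F
  constructor
  · rintro ⟨hF, hi⟩
    obtain ⟨hne, w, rfl⟩ := mem_faces_iff.1 hF
    obtain ⟨g, hg, hgw⟩ := exists_fold hs.arr hs.center subset_rfl
      (finite_reflectionGroup hs.arr) (fun H hH => reflection_mem_group hH) w
    refine ⟨g⁻¹, inv_mem hg, face (convexHull ℝ (orbitSet ℋ T)) (g w), ⟨⟨g w, hgw, rfl⟩, ?_⟩, ?_⟩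
    · rw [← image_face_orbitSet hg, dim_image, hi]
    · rw [image_face_orbitSet (inv_mem hg)]
      congr 1
      exact (g.symm_apply_apply w).symm
  · rintro ⟨g, hg, F, hF, rfl⟩
    obtain ⟨⟨w, hw, rfl⟩, hi⟩ := hF
    refine ⟨?_, by rw [dim_image, hi]⟩
    obtain ⟨x, hx⟩ := hs.face_nonempty w
    rw [image_face_orbitSet hg]
    refine mem_faces_iff.2 ⟨?_, _, rfl⟩
    rw [← image_face_orbitSet hg]
    exact ⟨_, x, hs.face_subset_face hw hx, rfl⟩

/-- A subset of the polytope itself has a trivial stabilizer. -/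
theorem IsSetup.stabilizer_eq_one (hs : IsSetup ℋ c T) {F : Set X} (hne : F.Nonempty)
    (hF : F ⊆ convexHull ℝ T) :
    {g : X ≃ₗᵢ[ℝ] X | g ∈ reflectionGroup ℋ ∧ g '' F = F}.ncard = 1 := by
  have : {g : X ≃ₗᵢ[ℝ] X | g ∈ reflectionGroup ℋ ∧ g '' F = F} = {1} := by
    ext g
    constructor
    · rintro ⟨hg, hgF⟩
      obtain ⟨x, hx⟩ := hne
      refine eq_one_of_mem_openChamber hs.arr hs.center hg (hs.subset (hF hx)) (hs.subset (hF ?_))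
      rw [← hgF]
      exact ⟨x, hx, rfl⟩
    · rintro rfl
      exact ⟨one_mem _, Set.image_id _⟩
  rw [this, Set.ncard_singleton]

theorem IsSetup.chamberFaces_zero_subset (hs : IsSetup ℋ c T) {F : Set X}
    (hF : F ∈ chamberFaces ℋ c T 0) : F ⊆ convexHull ℝ T := by
  obtain ⟨⟨w, hw, rfl⟩, hi⟩ := hF
  obtain ⟨x, hx⟩ := hs.face_nonempty w
  intro y hy
  rw [dim_eq_zero_iff.1 hi hy (hs.face_subset_face hw hx)]
  exact hx.1

/-- An edge of the symmetrization that is not an edge of the polytope is turned around by a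
reflection. -/
theorem IsSetup.stabilizer_eq_two (hs : IsSetup ℋ c T) {F : Set X}
    (hF : F ∈ chamberFaces ℋ c T 1) (hnot : ¬ F ⊆ convexHull ℝ T) :
    {g : X ≃ₗᵢ[ℝ] X | g ∈ reflectionGroup ℋ ∧ g '' F = F}.ncard = 2 := by
  obtain ⟨⟨w, hw, rfl⟩, hi⟩ := hF
  -- Without a mirror through `w` no nontrivial element contributes to the face, which would then
  -- lie in the polytope.
  obtain ⟨H, hH, hwH⟩ : ∃ H ∈ ℋ, w ∈ H := by
    by_contra hall
    push Not at hall
    apply hnot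
    rw [face_convexHull]
    refine convexHull_min ?_ (convex_convexHull ℝ T)
    rintro y ⟨hy, hyf⟩
    obtain ⟨g, hg, -, x, hx, rfl⟩ := hs.exists_of_mem_face hw hy hyf
    have hempty : {H | H ∈ ℋ ∧ w ∈ H} = ∅ := by
      ext H
      simp only [Set.mem_empty_iff_false, iff_false]
      exact fun h => hall H h.1 h.2
    have h1 : g = 1 := by
      rw [hempty] at hg
      simpa [reflectionGroup] using hg
    rw [h1]
    exact hx.1
  obtain ⟨v, hv⟩ := hs.face_nonempty w
  have hyp := hs.arr.hyperplane H hH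
  have hcH := hs.center H hH
  have hvo := hs.subset hv.1
  have hrG := reflection_mem_group hH
  have hrw : H.reflection w = w := Submodule.reflection_mem_subspace_eq_self hwH
  have hspan : vectorSpan ℝ (face (convexHull ℝ (orbitSet ℋ T)) w) = ℝ ∙ normal c H := by
    symm
    apply Submodule.eq_of_le_of_finrank_eq
    · rw [Submodule.span_singleton_le_iff_mem]
      exact hs.normal_mem_vectorSpan hw hH hwH
    · rw [finrank_span_singleton (normal_ne_zero hcH)]
      exact hi.symm
  have hstab : {g : X ≃ₗᵢ[ℝ] X | g ∈ reflectionGroup ℋ ∧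
      g '' face (convexHull ℝ (orbitSet ℋ T)) w = face (convexHull ℝ (orbitSet ℋ T)) w} =
      {1, H.reflection} := by
    ext g
    constructor
    · rintro ⟨hg, hgF⟩
      have hgw := hs.apply_eq_of_face_eq hw hw hg hgF
      have h1 := vsub_mem_vectorSpan ℝ (hs.map_mem_face hw hv hg hgw) (hs.face_subset_face hw hv)
      rw [hspan, Submodule.mem_span_singleton] at h1
      obtain ⟨a, ha⟩ := h1
      have hgv : g v = v + a • normal c H := by rw [ha, vsub_eq_sub]; abel
      have hn := inner_normal_pos hcH
      have h2 := g.inner_map_map v v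
      rw [hgv, inner_add_left, inner_add_right, inner_add_right, real_inner_smul_left,
        real_inner_smul_left, inner_smul_right, inner_smul_right,
        real_inner_comm (normal c H) v] at h2
      -- A stabilizing element moves `v` along the normal and preserves its norm; the two roots are
      -- the identity and the reflection in `H`.
      have h3 : a * (2 * inner ℝ (normal c H) v + a * inner ℝ (normal c H) (normal c H)) = 0 := by
        linarith
      rcases mul_eq_zero.1 h3 with h4 | h4
      · left
        refine eq_one_of_mem_openChamber hs.arr hs.center hg hvo ?_
        rwa [hgv, h4, zero_smul, add_zero]
      · right
        have ha' : a = -(2 * inner ℝ (normal c H) v / inner ℝ (normal c H) (normal c H)) := by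
          rw [← neg_div, eq_div_iff hn.ne']
          linarith
        have h5 : g v = H.reflection v := by
          rw [hgv, reflection_eq hyp hcH, ha', neg_smul, ← sub_eq_add_neg]
        have h6 : H.reflection * g = 1 := by
          refine eq_one_of_mem_openChamber hs.arr hs.center (mul_mem hrG hg) hvo ?_
          rw [show (H.reflection * g) v = H.reflection (g v) from rfl, h5,
            Submodule.reflection_reflection]
          exact hvo
        have h7 := eq_inv_of_mul_eq_one_right h6
        rwa [Submodule.reflection_inv] at h7
    · rintro (rfl | rfl)
      · exact ⟨one_mem _, Set.image_id _⟩
      · exact ⟨hrG, by rw [image_face_orbitSet hrG, hrw]⟩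
  rw [hstab, Set.ncard_pair]
  intro h1
  have h2 : inner ℝ (normal c H) (H.reflection v) = -inner ℝ (normal c H) v :=
    inner_normal_reflection H v
  rw [← h1, show (1 : X ≃ₗᵢ[ℝ] X) v = v from rfl] at h2
  linarith [hvo H hH]

/-- If some functional of the open chamber is constant on the polytope, then its faces are the
faces of the symmetrization that belong to the chamber and are contained in the polytope. -/
theorem IsSetup.chamberFaces_inter (hs : IsSetup ℋ c T) {γ : X} (hγ : γ ∈ openChamber ℋ c)
    (hconst : ∀ x ∈ convexHull ℝ T, ∀ y ∈ convexHull ℝ T, inner ℝ γ x = inner ℝ γ y) (i : ℕ) :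
    {F | F ∈ chamberFaces ℋ c T i ∧ F ⊆ convexHull ℝ T} =
      {F | F ∈ faces (convexHull ℝ T) ∧ dim F = i} := by
  ext F
  constructor
  · rintro ⟨⟨⟨w, hw, rfl⟩, hi⟩, hsub⟩
    refine ⟨mem_faces_iff.2 ⟨?_, w, ?_⟩, hi⟩
    · obtain ⟨x, hx⟩ := hs.face_nonempty w
      exact ⟨x, hs.face_subset_face hw hx⟩
    · exact Set.Subset.antisymm (fun x hx => mem_face_of_mem_face_orbitSet hx (hsub hx))
        (hs.face_subset_face hw)
  · rintro ⟨hF, hi⟩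
    obtain ⟨hne, w₀, rfl⟩ := mem_faces_iff.1 hF
    obtain ⟨ε, hε, hε0⟩ := ((eventually_pos_add_smul hs.arr.finite hγ w₀).and
      self_mem_nhdsWithin).exists
    have hε0 : 0 < ε := hε0
    -- Adding `γ` does not change the face of the polytope but moves the functional into the open
    -- chamber, where no mirror can enlarge the face.
    set w := γ + ε • w₀ with hwdef
    have hw : w ∈ openChamber ℋ c := hε
    have hw' := openChamber_subset ℋ c hw
    have hface : face (convexHull ℝ T) w = face (convexHull ℝ T) w₀ := by
      ext x
      refine and_congr_right fun hx => forall₂_congr fun y hy => ?_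
      rw [hwdef, inner_add_left, inner_add_left, real_inner_smul_left, real_inner_smul_left,
        hconst x hx y hy, add_le_add_iff_left, mul_le_mul_iff_right₀ hε0]
    have heq : face (convexHull ℝ (orbitSet ℋ T)) w = face (convexHull ℝ T) w := by
      refine Set.Subset.antisymm ?_ (hs.face_subset_face hw')
      rw [face_convexHull]
      refine convexHull_min ?_ (convex_face (convex_convexHull ℝ T) w)
      rintro y ⟨hy, hyf⟩
      obtain ⟨g, hg, hgG, x, hx, rfl⟩ := hs.exists_of_mem_face hw' hy hyf
      have h1 : g = 1 := eq_one_of_mem_openChamber hs.arr hs.center hgG hw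
        (by rw [apply_eq_of_mem_closure hg]; exact hw)
      rw [h1]
      exact hx
    refine ⟨⟨⟨w, hw', ?_⟩, hi⟩, face_subset _ _⟩
    rw [heq, hface]

theorem IsSetup.fVector_zero (hs : IsSetup ℋ c T) :
    fVector (convexHull ℝ (orbitSet ℋ T)) 0 =
      (reflectionGroup ℋ : Set (X ≃ₗᵢ[ℝ] X)).ncard * (chamberFaces ℋ c T 0).ncard := by
  have h := ncard_orbits (finite_reflectionGroup hs.arr) (hs.chamberFaces_finite 0) (m := 1)
    (fun F hF F' hF' g hg he => hs.eq_of_image_eq hF hF' hg he)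
    (fun F hF => hs.stabilizer_eq_one (hs.chamberFaces_subset 0 hF).1.1
      (hs.chamberFaces_zero_subset hF))
  rw [one_mul, ← hs.faces_eq] at h
  exact h

/-- Chamber edges inside the polytope have free orbits, the others orbits of half that size. In the
doubled count the former therefore count twice, and they are precisely the edges of the polytope. -/
theorem IsSetup.two_mul_fVector_one (hs : IsSetup ℋ c T) {γ : X} (hγ : γ ∈ openChamber ℋ c)
    (hconst : ∀ x ∈ convexHull ℝ T, ∀ y ∈ convexHull ℝ T, inner ℝ γ x = inner ℝ γ y) :
    2 * fVector (convexHull ℝ (orbitSet ℋ T)) 1 =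
      (reflectionGroup ℋ : Set (X ≃ₗᵢ[ℝ] X)).ncard *
        ((chamberFaces ℋ c T 1).ncard + fVector (convexHull ℝ T) 1) := by
  set P := convexHull ℝ T
  set G := reflectionGroup ℋ
  let 𝒜 : Set (Set X) := {F | F ∈ chamberFaces ℋ c T 1 ∧ F ⊆ P}
  let ℬ : Set (Set X) := {F | F ∈ chamberFaces ℋ c T 1 ∧ ¬ F ⊆ P}
  have hfin := hs.chamberFaces_finite 1
  have hGfin := finite_reflectionGroup hs.arr
  have h𝒜fin : 𝒜.Finite := hfin.subset fun F hF => hF.1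
  have hℬfin : ℬ.Finite := hfin.subset fun F hF => hF.1
  have h𝒜 := ncard_orbits hGfin h𝒜fin (m := 1)
    (fun F hF F' hF' g hg he => hs.eq_of_image_eq hF.1 hF'.1 hg he)
    (fun F hF => hs.stabilizer_eq_one (hs.chamberFaces_subset 1 hF.1).1.1 hF.2)
  have hℬ := ncard_orbits hGfin hℬfin (m := 2)
    (fun F hF F' hF' g hg he => hs.eq_of_image_eq hF.1 hF'.1 hg he)
    (fun F hF => hs.stabilizer_eq_two hF.1 hF.2)
  set 𝒜' := {F' | ∃ g ∈ G, ∃ F ∈ 𝒜, F' = g '' F}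
  set ℬ' := {F' | ∃ g ∈ G, ∃ F ∈ ℬ, F' = g '' F}
  have hunion : chamberFaces ℋ c T 1 = 𝒜 ∪ ℬ := by
    ext F
    by_cases hF : F ⊆ P <;> simp [𝒜, ℬ, hF]
  have hdisj : Disjoint 𝒜 ℬ := Set.disjoint_left.2 fun F hF hF' => hF'.2 hF.2
  have hcard : (chamberFaces ℋ c T 1).ncard = 𝒜.ncard + ℬ.ncard := by
    rw [hunion, Set.ncard_union_eq hdisj h𝒜fin hℬfin]
  have hfaces : {F | F ∈ faces (convexHull ℝ (orbitSet ℋ T)) ∧ dim F = 1} = 𝒜' ∪ ℬ' := by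
    rw [hs.faces_eq, hunion]
    ext F'
    constructor
    · rintro ⟨g, hg, F, hF | hF, rfl⟩
      · exact Or.inl ⟨g, hg, F, hF, rfl⟩
      · exact Or.inr ⟨g, hg, F, hF, rfl⟩
    · rintro (⟨g, hg, F, hF, rfl⟩ | ⟨g, hg, F, hF, rfl⟩)
      · exact ⟨g, hg, F, Or.inl hF, rfl⟩
      · exact ⟨g, hg, F, Or.inr hF, rfl⟩
  have hallfin : {F | F ∈ faces (convexHull ℝ (orbitSet ℋ T)) ∧ dim F = 1}.Finite :=
    hs.faces_finite.subset fun F hF => hF.1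
  have h𝒜'fin : 𝒜'.Finite := hallfin.subset (hfaces ▸ Set.subset_union_left)
  have hℬ'fin : ℬ'.Finite := hallfin.subset (hfaces ▸ Set.subset_union_right)
  have hdisj' : Disjoint 𝒜' ℬ' := by
    refine Set.disjoint_left.2 ?_
    rintro _ ⟨g, hg, F, hF, rfl⟩ ⟨g', hg', F', hF', he⟩
    have he' : (g'⁻¹ * g : X ≃ₗᵢ[ℝ] X) '' F = F' := by
      rw [mul_image, he, ← mul_image, inv_mul_cancel]
      exact Set.image_id _
    have := hs.eq_of_image_eq hF.1 hF'.1 (mul_mem (inv_mem hg') hg) he'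
    exact hF'.2 (this ▸ hF.2)
  have hf : fVector (convexHull ℝ (orbitSet ℋ T)) 1 = 𝒜'.ncard + ℬ'.ncard := by
    rw [fVector, hfaces, Set.ncard_union_eq hdisj' h𝒜'fin hℬ'fin]
  have hP : fVector P 1 = 𝒜.ncard := by
    rw [fVector, ← hs.chamberFaces_inter hγ hconst 1]
  rw [hf, hcard, hP]
  linarith

theorem IsSetup.fVector_zero_polytope (hs : IsSetup ℋ c T) {γ : X} (hγ : γ ∈ openChamber ℋ c)
    (hconst : ∀ x ∈ convexHull ℝ T, ∀ y ∈ convexHull ℝ T, inner ℝ γ x = inner ℝ γ y) :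
    fVector (convexHull ℝ T) 0 = (chamberFaces ℋ c T 0).ncard := by
  rw [fVector, ← hs.chamberFaces_inter hγ hconst 0]
  congr 1
  ext F
  exact ⟨fun hF => hF.1, fun hF => ⟨hF, hs.chamberFaces_zero_subset hF⟩⟩

/-- For `w = 0` the face is the whole symmetrization, so its direction contains the normals of all
mirrors, whose common orthogonal complement is zero. -/
theorem IsSetup.dim_symmetrization (hs : IsSetup ℋ c T) :
    dim (convexHull ℝ (orbitSet ℋ T)) = finrank ℝ X := by
  have htop : vectorSpan ℝ (convexHull ℝ (orbitSet ℋ T)) = ⊤ := by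
    rw [← Submodule.orthogonal_eq_bot_iff, eq_bot_iff, ← hs.arr.essential]
    intro u hu
    rw [Submodule.mem_sInf]
    intro H hH
    have h0 : (0 : X) ∈ closedChamber ℋ c := fun K _ => by simp
    have h1 := hs.normal_mem_vectorSpan h0 hH (zero_mem H)
    rw [face_zero] at h1
    exact (mem_iff_inner_normal (hs.arr.hyperplane H hH) (hs.center H hH)).2
      ((Submodule.mem_orthogonal _ _).1 hu _ h1)
  rw [dim, htop, finrank_top]

/-- The number of edges of a polytope of dimension at most two with `n` vertices. -/
def edgeCount (n : ℕ) : ℕ := if n = 1 then 0 else if n = 2 then 1 else n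

/-- Euler's relation settles each dimension; the bound `dim_lt_fVector_zero` shows that a polygon
has at least three vertices, so the vertex number tells the dimensions apart. -/
theorem fVector_one_of_dim_le_two (hT : T.Finite) (hne : T.Nonempty)
    (hdim : dim (convexHull ℝ T) ≤ 2) :
    fVector (convexHull ℝ T) 1 = edgeCount (fVector (convexHull ℝ T) 0) := by
  have h1 := euler_fVector hT hne (n := 3) (by omega)
  have h2 := dim_lt_fVector_zero hT hne
  have h3 := fVector_dim (K := convexHull ℝ T) hne.convexHull
  have h4 : ∀ i, dim (convexHull ℝ T) < i → fVector (convexHull ℝ T) i = 0 :=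
    fun i hi => fVector_eq_zero hi
  simp only [Finset.sum_range_succ, Finset.sum_range_zero] at h1
  unfold edgeCount
  generalize fVector (convexHull ℝ T) = f at *
  generalize dim (convexHull ℝ T) = d at *
  interval_cases d
  · simp [h3, h4 1 (by omega)]
  · have := h4 2 (by omega)
    rw [this, h3] at h1
    have : f 0 = 2 := by norm_num at h1; omega
    simp [h3, this]
  · rw [h3] at h1
    have : f 1 = f 0 := by norm_num at h1; omega
    rw [this, if_neg (by omega), if_neg (by omega)]

/-- The `f`-vector of the symmetrization, in terms of the order `N` of the group, the dimension `d`
of the space and the numbers `a` and `b` of cones of codimension 0 and 1 in the fundamental fan. -/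
def symFVector (N d a b i : ℕ) : ℕ :=
  if d < i then 0
  else if i = d then 1
  else if i = 0 then N * a
  else if d = 2 then N * a
  else if i = 1 then N * (b + edgeCount a) / 2
  -- On actual face numbers the division is exact, and adding `2` first keeps the subtraction from
  -- truncating.
  else N * (b + edgeCount a) / 2 + 2 - N * a

theorem IsSetup.fVector_eq (hs : IsSetup ℋ c T) (hX : finrank ℝ X ≤ 3) {γ : X}
    (hγ : γ ∈ openChamber ℋ c)
    (hconst : ∀ x ∈ convexHull ℝ T, ∀ y ∈ convexHull ℝ T, inner ℝ γ x = inner ℝ γ y) (i : ℕ) :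
    fVector (convexHull ℝ (orbitSet ℋ T)) i =
      symFVector (reflectionGroup ℋ : Set (X ≃ₗᵢ[ℝ] X)).ncard (finrank ℝ X)
        (chamberFaces ℋ c T 0).ncard (chamberFaces ℋ c T 1).ncard i := by
  have hdim := hs.dim_symmetrization
  have hfin := orbitSet_finite hs.arr hs.finite
  have hne : (orbitSet ℋ T).Nonempty := hs.nonempty.mono (subset_orbitSet ℋ T)
  have hd := fVector_dim (K := convexHull ℝ (orbitSet ℋ T)) hne.convexHull
  rw [hdim] at hd
  unfold symFVector
  split_ifs with h1 h2 h3 h4 h5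
  · exact fVector_eq_zero (hdim ▸ h1)
  · rw [h2, hd]
  · rw [h3, hs.fVector_zero]
  · have hi : i = 1 := by omega
    have he := euler_fVector hfin hne (n := 3) (by omega)
    rw [h4] at hd
    simp only [Finset.sum_range_succ, Finset.sum_range_zero, hd] at he
    rw [hi, ← hs.fVector_zero]
    norm_num at he
    omega
  all_goals
    have hX3 : finrank ℝ X = 3 := by omega
    -- Zero is in the open chamber only if there are no mirrors, and then their intersection would
    -- be the whole three-dimensional space.
    have hγ0 : γ ≠ 0 := by
      rintro rfl
      have hempty : ℋ = ∅ := by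
        by_contra hne
        obtain ⟨H, hH⟩ := Set.nonempty_iff_ne_empty.2 hne
        have := hγ H hH
        simp at this
      have htop := hs.arr.essential
      rw [hempty, sInf_empty] at htop
      have h6 : finrank ℝ (⊤ : Submodule ℝ X) = 0 := by rw [htop, finrank_bot]
      rw [finrank_top] at h6
      omega
    have hdimP : dim (convexHull ℝ T) ≤ 2 := by
      have hle : vectorSpan ℝ (convexHull ℝ T) ≤ (ℝ ∙ γ)ᗮ := fun v hv =>
        Submodule.mem_orthogonal_singleton_iff_inner_right.2
          (inner_eq_zero_of_mem_vectorSpan hconst hv)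
      have h6 := Submodule.finrank_mono hle
      have h7 := (ℝ ∙ γ).finrank_add_finrank_orthogonal
      rw [finrank_span_singleton hγ0] at h7
      change finrank ℝ (vectorSpan ℝ (convexHull ℝ T)) ≤ 2
      omega
    have he2 := hs.two_mul_fVector_one hγ hconst
    rw [fVector_one_of_dim_le_two hs.finite hs.nonempty hdimP,
      hs.fVector_zero_polytope hγ hconst] at he2
    have hE : (reflectionGroup ℋ : Set (X ≃ₗᵢ[ℝ] X)).ncard * ((chamberFaces ℋ c T 1).ncard +
        edgeCount (chamberFaces ℋ c T 0).ncard) / 2 =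
        fVector (convexHull ℝ (orbitSet ℋ T)) 1 := by omega
    rw [hE]
  · rw [h5]
  · have hi : i = 2 := by omega
    have he := euler_fVector hfin hne (n := 4) (by omega)
    rw [hX3] at hd
    simp only [Finset.sum_range_succ, Finset.sum_range_zero, hd] at he
    rw [hi, ← hs.fVector_zero]
    norm_num at he
    omega

end Counting

/-! ### Transfer between `V` and `x₀ + V` -/

section Transfer

variable {E : Type*} [NormedAddCommGroup E] [InnerProductSpace ℝ E]

/-- The identification of `V` with `x₀ + V`. -/
def translate (V : Submodule ℝ E) (x₀ : E) : V →ᵃ[ℝ] E :=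
  V.subtype.toAffineMap + AffineMap.const ℝ V x₀

theorem translate_apply (V : Submodule ℝ E) (x₀ : E) (v : V) : translate V x₀ v = v + x₀ := rfl

theorem translate_injective (V : Submodule ℝ E) (x₀ : E) : Function.Injective (translate V x₀) :=
  fun v w h => by simpa [translate_apply] using h

variable {V : Submodule ℝ E} {x₀ : E}

theorem dim_translate (F : Set V) : dim (translate V x₀ '' F) = dim F := by
  have hlin : (translate V x₀).linear = V.subtype := by
    ext v
    simp [translate]
  rw [dim, ← AffineMap.map_vectorSpan, hlin]
  exact Submodule.finrank_map_subtype_eq _ _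

theorem pairing_translate (w v : V) : pairing x₀ w (translate V x₀ v) = inner ℝ w v := by
  simp [pairing, translate_apply]

theorem normalCone_translate (F K : Set V) :
    normalCone V x₀ (translate V x₀ '' F) (translate V x₀ '' K) = maxCone F K := by
  ext w
  simp only [normalCone, maxCone, Set.mem_ofPred_eq, Set.forall_mem_image, pairing_translate]

theorem mem_relInterior_of_translate {K : Set V} {v : V}
    (h : translate V x₀ v ∈ relInterior (translate V x₀ '' K)) : v ∈ relInterior K := by
  refine ⟨(translate_injective V x₀).mem_set_image.1 h.1, fun y hy => ?_⟩
  obtain ⟨ε, hε, hm⟩ := h.2 _ ⟨y, hy, rfl⟩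
  refine ⟨ε, hε, ?_⟩
  rw [← (translate_injective V x₀).mem_set_image]
  convert hm using 1
  simp only [translate_apply, Submodule.coe_add, Submodule.coe_smul, Submodule.coe_sub]
  module

theorem mem_openChamber_of_relInterior {X : Type*} [NormedAddCommGroup X] [InnerProductSpace ℝ X]
    [FiniteDimensional ℝ X] {ℋ : Set (Submodule ℝ X)} {c : X} (hc : ∀ H ∈ ℋ, c ∉ H) {x : X}
    (hx : x ∈ relInterior (closedChamber ℋ c)) : x ∈ openChamber ℋ c := by
  intro H hH
  obtain ⟨ε, hε, h⟩ := hx.2 c (openChamber_subset ℋ c (center_mem_openChamber hc))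
  have h1 := h H hH
  rw [inner_add_right, inner_smul_right, inner_sub_right] at h1
  have h2 := inner_normal_center_pos (hc H hH)
  by_contra hneg
  push Not at hneg
  nlinarith

theorem chamber_eq_closedChamber {X : Type*} [NormedAddCommGroup X] [InnerProductSpace ℝ X]
    [FiniteDimensional ℝ X] {ℋ : Set (Submodule ℝ X)} {c : X} (h : IsReflectionArrangement ℋ)
    (hc : ∀ H ∈ ℋ, c ∉ H) :
    {w | ∀ H ∈ ℋ, ∀ n ∈ Hᗮ, 0 < inner ℝ n c → 0 ≤ inner ℝ n w} = closedChamber ℋ c := by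
  ext w
  constructor
  · intro hw H hH
    exact hw H hH _ (normal_mem c H) (inner_normal_center_pos (hc H hH))
  · intro hw H hH n hn hnc
    rw [orthogonal_eq_span_normal (h.hyperplane H hH) (hc H hH), Submodule.mem_span_singleton] at hn
    obtain ⟨a, rfl⟩ := hn
    rw [real_inner_smul_left] at hnc ⊢
    have ha : 0 < a := pos_of_mul_pos_left hnc (inner_normal_center_pos (hc H hH)).le
    exact mul_nonneg ha.le (hw H hH)

variable [FiniteDimensional ℝ E]

/-- On the translate, pairing with `e` differs from pairing with its projection to `V` only by a
constant. -/
theorem face_translate (K : Set V) (e : E) :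
    face (translate V x₀ '' K) e = translate V x₀ '' face K (V.orthogonalProjectionOnto e) := by
  have key : ∀ v : V, inner ℝ e (translate V x₀ v) =
      inner ℝ (V.orthogonalProjectionOnto e) v + inner ℝ e x₀ := by
    intro v
    rw [translate_apply, inner_add_right]
    congr 1
    simp
  ext y
  constructor
  · rintro ⟨⟨v, hv, rfl⟩, h⟩
    refine ⟨v, ⟨hv, fun z hz => ?_⟩, rfl⟩
    have := h _ ⟨z, hz, rfl⟩
    rw [key, key] at this
    linarith
  · rintro ⟨v, hv, rfl⟩
    refine ⟨⟨v, hv.1, rfl⟩, ?_⟩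
    rintro _ ⟨z, hz, rfl⟩
    rw [key, key]
    linarith [hv.2 z hz]

theorem faces_translate (K : Set V) :
    faces (translate V x₀ '' K) = (fun F => translate V x₀ '' F) '' faces K := by
  ext F
  constructor
  · intro hF
    obtain ⟨hne, e, rfl⟩ := mem_faces_iff.1 hF
    rw [face_translate] at hne ⊢
    exact ⟨_, mem_faces_iff.2 ⟨Set.image_nonempty.1 hne, _, rfl⟩, rfl⟩
  · rintro ⟨F, hF, rfl⟩
    obtain ⟨hne, w, rfl⟩ := mem_faces_iff.1 hF
    refine mem_faces_iff.2 ⟨hne.image _, w, ?_⟩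
    rw [face_translate, Submodule.orthogonalProjectionOnto_mem_subspace_eq_self]

theorem fVector_translate (K : Set V) (i : ℕ) :
    fVector (translate V x₀ '' K) i = fVector K i := by
  have : {F | F ∈ faces (translate V x₀ '' K) ∧ dim F = i} =
      (fun F => translate V x₀ '' F) '' {F | F ∈ faces K ∧ dim F = i} := by
    rw [faces_translate]
    ext F
    constructor
    · rintro ⟨⟨F, hF, rfl⟩, hi⟩
      exact ⟨F, ⟨hF, by rwa [dim_translate] at hi⟩, rfl⟩
    · rintro ⟨F, ⟨hF, hi⟩, rfl⟩
      exact ⟨⟨F, hF, rfl⟩, by rwa [dim_translate]⟩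
  rw [fVector, this]
  exact Set.ncard_image_of_injective _ (translate_injective V x₀).image_injective

theorem fundamentalFan_translate (Φ K : Set V) :
    fundamentalFan Φ x₀ (translate V x₀ '' K) = chamberFan Φ K := by
  ext τ
  simp only [fundamentalFan, normalFan, chamberFan, faces_translate]
  constructor
  · rintro ⟨_, ⟨_, ⟨F, hF, rfl⟩, rfl⟩, hτ⟩
    exact ⟨F, hF, by rwa [normalCone_translate] at hτ⟩
  · rintro ⟨F, hF, hτ⟩
    exact ⟨_, ⟨_, ⟨F, hF, rfl⟩, rfl⟩, by rwa [normalCone_translate]⟩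

theorem symmetrization_translate (ℋ : Set (Submodule ℝ V)) (T : Set V) :
    symmetrization (reflectionGroup ℋ) x₀ (translate V x₀ '' convexHull ℝ T) =
      translate V x₀ '' convexHull ℝ (orbitSet ℋ T) := by
  have h1 : {y | ∃ g ∈ reflectionGroup ℋ, ∃ x ∈ translate V x₀ '' convexHull ℝ T,
      y = rightAction x₀ x g} = translate V x₀ '' orbitSet ℋ (convexHull ℝ T) := by
    have key : ∀ (g : V ≃ₗᵢ[ℝ] V) (v : V),
        rightAction x₀ (translate V x₀ v) g = translate V x₀ (g⁻¹ v) := by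
      intro g v
      simp only [rightAction, translate_apply, add_sub_cancel_right,
        Submodule.orthogonalProjectionOnto_mem_subspace_eq_self]
      abel
    ext y
    constructor
    · rintro ⟨g, hg, _, ⟨v, hv, rfl⟩, rfl⟩
      exact ⟨g⁻¹ v, ⟨g⁻¹, inv_mem hg, v, hv, rfl⟩, (key g v).symm⟩
    · rintro ⟨_, ⟨g, hg, v, hv, rfl⟩, rfl⟩
      exact ⟨g⁻¹, inv_mem hg, _, ⟨v, hv, rfl⟩, by rw [key, inv_inv]⟩
  rw [symmetrization, h1, ← AffineMap.image_convexHull]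
  congr 1
  refine Set.Subset.antisymm (convexHull_min ?_ (convex_convexHull ℝ _)) (convexHull_mono ?_)
  · rintro _ ⟨g, hg, x, hx, rfl⟩
    rw [← image_hull_orbitSet hg]
    exact ⟨x, hull_subset_hull_orbitSet ℋ T hx, rfl⟩
  · rintro _ ⟨g, hg, x, hx, rfl⟩
    exact ⟨g, hg, x, subset_convexHull ℝ T hx, rfl⟩

end Transfer

end PolytopeSymmetrization

end

/-! ### The main theorem -/

theorem mainTheorem12 {E : Type*} [NormedAddCommGroup E] [InnerProductSpace ℝ E]
    [FiniteDimensional ℝ E] (V : Submodule ℝ E) (hV : Module.finrank ℝ V ≤ 3)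
    (ℋ : Set (Submodule ℝ V)) (hℋ : PolytopeSymmetrization.IsReflectionArrangement ℋ) :
    ∃ f : ℕ → ℕ → (ℕ → ℕ),
      ∀ Φ : Set V, PolytopeSymmetrization.IsChamber ℋ Φ →
      ∀ x₀ ∈ Vᗮ, ∀ P : Set E,
        PolytopeSymmetrization.IsPolytopeIn
          (PolytopeSymmetrization.affineTranslate V x₀) P →
        PolytopeSymmetrization.IsPlaced Φ x₀ P →
        PolytopeSymmetrization.IsAppropriate
          (PolytopeSymmetrization.dualChamber Φ x₀) P →
        PolytopeSymmetrization.fVector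
            (PolytopeSymmetrization.symmetrization
              (PolytopeSymmetrization.reflectionGroup ℋ) x₀ P) =
          f (PolytopeSymmetrization.fanNumber
              (PolytopeSymmetrization.fundamentalFan Φ x₀ P) 0)
            (PolytopeSymmetrization.fanNumber
              (PolytopeSymmetrization.fundamentalFan Φ x₀ P) 1) := by
  open PolytopeSymmetrization in
  -- Besides `a` and `b`, only the order of the group and the dimension of `V` enter.
  refine ⟨fun a b i => symFVector (reflectionGroup ℋ : Set (V ≃ₗᵢ[ℝ] V)).ncard
    (Module.finrank ℝ V) a b i, ?_⟩
  rintro Φ ⟨c, hc, hΦ⟩ x₀ - P ⟨s, hs, hsne, hsU, rfl⟩ ⟨γ, hγP, hγ⟩ happ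
  rw [chamber_eq_closedChamber hℋ hc] at hΦ
  subst hΦ
  have hst : translate V x₀ '' (translate V x₀ ⁻¹' s) = s :=
    Set.image_preimage_eq_of_subset fun u hu => ⟨⟨u - x₀, hsU hu⟩, sub_add_cancel u x₀⟩
  set T : Set V := translate V x₀ ⁻¹' s
  have hP : convexHull ℝ s = translate V x₀ '' convexHull ℝ T := by
    rw [AffineMap.image_convexHull, hst]
  rw [hP] at hγP happ ⊢
  have hdual : dualChamber (closedChamber ℋ c) x₀ = translate V x₀ '' closedChamber ℋ c := by
    ext u
    constructor
    · rintro ⟨w, hw, rfl⟩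
      exact ⟨w, hw, add_comm _ _⟩
    · rintro ⟨w, hw, rfl⟩
      exact ⟨w, hw, add_comm _ _⟩
  have hset : IsSetup ℋ c T :=
    { arr := hℋ
      center := hc
      finite := hs.preimage (translate_injective V x₀).injOn
      nonempty := by rw [← Set.image_nonempty (f := translate V x₀), hst]; exact hsne
      subset := fun v hv => by
        refine mem_openChamber_of_relInterior hc (mem_relInterior_of_translate (x₀ := x₀) ?_)
        rw [← hdual]
        exact mem_relInterior_of_mem_intrinsicInterior (happ ⟨v, hv, rfl⟩) }
  funext i
  rw [symmetrization_translate, fVector_translate, fundamentalFan_translate, hset.fanNumber_eq,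
    hset.fanNumber_eq]
  refine hset.fVector_eq hV (mem_openChamber_of_relInterior hc
    (mem_relInterior_of_mem_intrinsicInterior hγ)) (fun x hx y hy => ?_) i
  have := hγP _ ⟨x, hx, rfl⟩ _ ⟨y, hy, rfl⟩
  rwa [pairing_translate, pairing_translate] at this
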